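/- Let $p\ge 2$ and $K\ge 1$. Let $\lambda_1,\dots,\lambda_K\ge 0$ with $\sum_j\lambda_j=1$, and let $\Theta=(\theta_{j_1\dots j_p})_{1\le j_1,\dots,j_p\le K}$ be a symmetric tensor with entries in $[0,1]$. For $N\ge 0$ split $\{1,\dots,N\}$ into the blocks $B_j=(N\sum_{k<j}\lambda_k,\ N\sum_{k\le j}\lambda_k]\cap\{1,\dots,N\}$. The hypergraph stochastic block model (HSBM) is the random $p$-uniform hypergraph $H_N$ on $\{1,\dots,N\}$ in which the sets $\{i_1<\dots<i_p\}$ are hyperedges independently, with probability $\theta_{j_1\dots j_p}$ if $i_1\in B_{j_1},\dots,i_p\in B_{j_p}$. Let $A_{H_N}=(a_{i_1\dots i_p})$ be its adjacency tensor ($a_{i_1\dots i_p}=1$ if $i_1,\dots,i_p$ are distinct and form a hyperedge, and $0$ otherwise), and $J_N=N^{-(p-1)}A_{H_N}$. Given $H_N$ and $\beta\ge0$, the Ising model is the law on $x\in\{-1,1\}^N$ $$\mathbb P_\beta(x)=\frac{e^{\beta \mathcal H_N(x)}}{2^N Z_N(\beta)},\qquad \mathcal H_N(x)=\sum_{i_1,\dots,i_p}J_{i_1\dots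 i_p}x_{i_1}\cdots x_{i_p},\qquad Z_N(\beta)=2^{-N}\sum_x e^{\beta \mathcal H_N(x)},$$ and $F_N(\beta)=\log Z_N(\beta)$. With $m_i(x)=\sum_{i_2,\dots,i_p}J_{ii_2\dots i_p}x_{i_2}\cdots x_{i_p}$, the maximum pseudo-likelihood (MPL) estimate is $$\hat\beta_N(x)=\inf\Big\{b\ge0:\ \mathcal H_N(x)=\sum_{i=1}^N m_i(x)\tanh(p\,b\,m_i(x))\Big\},\qquad \inf\emptyset=+\infty .$$ Let $I(t)=\frac12\{(1+t)\log(1+t)+(1-t)\log(1-t)\}$ (with $0\log 0=0$), $$\phi_\beta(t_1,\dots,t_K)=\beta\sum_{j_1,\dots,j_p}\theta_{j_1\dots j_p}\prod_{\ell=1}^p\lambda_{j_\ell}t_{j_\ell}-\sum_{j=1}^K\lambda_jI(t_j),$$ $$\beta^*_{\mathrm{HSBM}}=\sup\Big\{\beta\ge0:\ \sup_{t\in[0,1]^K}\phi_\beta(t)=0\Big\}\in[0,\infty].$$ Let $(H_N)_{N\ge0}$ be random hypergraphs, defined on one probability space with an arbitrary joint distribution, such that each $H_N$ has the HSBM law.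 A sequence of estimators $\hat\beta_N$ is called consistent at $\beta$ if $\mathbb P_\beta(|\hat\beta_N(X)-\beta|\le\varepsilon)\to1$ for every $\varepsilon>0$. Then: 1. ($\sqrt N$-consistency of MPL.) For every real $\beta>\beta^*_{\mathrm{HSBM}}$ and every $\delta>0$ there is a deterministic $M>0$ such that, for almost every realization of $(H_N)$, the MPL estimate satisfies $\mathbb P_\beta(\sqrt N\,|\hat\beta_N(X)-\beta|\le M)>1-\delta$ for all sufficiently large $N$. 2. (No consistent estimator.) For almost every realization of $(H_N)$ the following holds: for all $0\le\beta_1<\beta_2<\beta^*_{\mathrm{HSBM}}$ no sequence of estimators $\hat\beta_N:\{-1,1\}^N\to[-\infty,\infty]$ (which may depend on the realization) is consistent both at $\beta_1$ and at $\beta_2$. 3. For every $0\le\beta<\beta^*_{\mathrm{HSBM}}$, $\mathbb E\,F_N(\beta)=O(1)$, where the expectation is over the HSBM. 4. For all $0\le\beta_1<\beta_2<\beta^*_{\mathrm{HSBM}}$ the Kullback–Leibler divergence $D(\mathbb Q_{N,\beta_1}\,\|\,\mathbb Q_{N,\beta_2})$ is bounded uniformly in $N$, where $\mathbb Q_{N,\beta}$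 is the joint law of $(H_N,X)$ with $H_N$ drawn from the HSBM and $X\sim\mathbb P_\beta$ given $H_N$. -/

import Mathlib

open MeasureTheory ProbabilityTheory Filter Topology

namespace HSBM

noncomputable section

/-! ### The `p`-tensor Ising model on `N` vertices -/

/-- A (real) `p`-tensor indexed by the vertices `Fin N`. -/
abbrev Tensor (p N : ℕ) : Type := (Fin p → Fin N) → ℝ

/-- Spin configurations, `{-1, 1}^N`; the spins are the two units of `ℤ`. -/
abbrev Config (N : ℕ) : Type := Fin N → ℤˣ

/-- Every set of spins is measurable. -/
instance instMeasurableSingletonClassSpin : MeasurableSingletonClass ℤˣ :=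
  ⟨fun s => ⟨{(s : ℤ)}, MeasurableSet.singleton _, by ext t; simp [Units.ext_iff]⟩⟩

/-- The value `1` or `-1` in `ℝ` of a spin. -/
def spin (s : ℤˣ) : ℝ := ((s : ℤ) : ℝ)

/-- The Hamiltonian `H_N(x) = ∑_{i₁, …, i_p} J_{i₁ … i_p} x_{i₁} ⋯ x_{i_p}`. -/
def hamiltonian {p N : ℕ} (J : Tensor p N) (x : Config N) : ℝ :=
  ∑ i : Fin p → Fin N, J i * ∏ l, spin (x (i l))

/-- The normalized partition function `Z_N(β) = 2^{-N} ∑_x exp (β H_N(x))`. -/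
def partition {p N : ℕ} (J : Tensor p N) (β : ℝ) : ℝ :=
  (1 / 2 ^ N) * ∑ x : Config N, Real.exp (β * hamiltonian J x)

/-- The log-partition function `F_N(β) = log Z_N(β)`. -/
def logPartition {p N : ℕ} (J : Tensor p N) (β : ℝ) : ℝ :=
  Real.log (partition J β)

/-- The law `ℙ_β` on `{-1, 1}^N`, with mass function `exp (β H_N(x)) / (2^N Z_N(β))`. -/
def ising {p N : ℕ} (J : Tensor p N) (β : ℝ) : Measure (Config N) :=
  ∑ x : Config N,
    ENNReal.ofReal (Real.exp (β * hamiltonian J x) / (2 ^ N * partition J β)) • Measure.dirac x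

/-- The local effect at the vertex `v`,
`m_v(x) = ∑_{i₂, …, i_p} J_{v i₂ … i_p} x_{i₂} ⋯ x_{i_p}`:
the sum runs over the index tuples whose first entry is `v`. -/
def localField {p N : ℕ} (J : Tensor p N) (x : Config N) (v : Fin N) : ℝ :=
  ∑ i : Fin p → Fin N with ∀ l : Fin p, l.val = 0 → i l = v,
    J i * ∏ l : Fin p with l.val ≠ 0, spin (x (i l))

/-- The maximum pseudo-likelihood estimate: the infimum of all `b ≥ 0` that solve
`H_N(x) = ∑_v m_v(x) tanh (p b m_v(x))`, equal to `+∞` if there is no solution. -/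
def mple {p N : ℕ} (J : Tensor p N) (x : Config N) : EReal :=
  sInf {c : EReal | ∃ b : ℝ, 0 ≤ b ∧ c = (b : EReal) ∧
    hamiltonian J x = ∑ v : Fin N, localField J x v * Real.tanh (p * b * localField J x v)}

/-- Consistency at `β` of a sequence of (extended-real-valued) estimators, based on one sample
from the Ising model with interaction tensor `J N` for every `N`. -/
def ConsistentAt {p : ℕ} (J : ∀ N, Tensor p N) (est : ∀ N, Config N → EReal) (β : ℝ) : Prop :=
  ∀ ε : ℝ, 0 < ε →
    Tendsto (fun N => (ising (J N) β).real
      {x | ∃ b : ℝ, est N x = (b : EReal) ∧ |b - β| ≤ ε}) atTop (𝓝 1)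

/-! ### The hypergraph stochastic block model -/

/-- The possible hyperedges of a `p`-uniform hypergraph on `N` vertices. -/
abbrev Hyperedge (p N : ℕ) : Type := {e : Finset (Fin N) // e.card = p}

/-- A `p`-uniform hypergraph on `N` vertices, through the indicator of its hyperedges. -/
abbrev Hypergraph (p N : ℕ) : Type := Hyperedge p N → Bool

/-- The adjacency tensor: `a_{i₁ … i_p} = 1` if `i₁, …, i_p` are distinct and form a hyperedge,
and `0` otherwise. -/
def adjTensor {p N : ℕ} (G : Hypergraph p N) : Tensor p N := fun i =>
  if h : (Finset.univ.image i).card = p then (if G ⟨Finset.univ.image i, h⟩ then 1 else 0) else 0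

/-- The interaction tensor `J_N = N^{-(p-1)} A_{H_N}`. -/
def interaction {p N : ℕ} (G : Hypergraph p N) : Tensor p N := fun i =>
  adjTensor G i / (N : ℝ) ^ (p - 1)

/-- The block `B_j = (N ∑_{k < j} λ_k, N ∑_{k ≤ j} λ_k] ∩ {1, …, N}`; the element `v : Fin N`
stands for the vertex `v + 1`. -/
def block {K : ℕ} (lam : Fin K → ℝ) (N : ℕ) (j : Fin K) : Set (Fin N) :=
  {v | (N : ℝ) * ∑ k ∈ Finset.Iio j, lam k < (v.val : ℝ) + 1 ∧
    (v.val : ℝ) + 1 ≤ (N : ℝ) * ∑ k ∈ Finset.Iic j, lam k}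

/-- When the `λ_j` are nonnegative and sum to `1`, every vertex lies in exactly one block. -/
theorem existsUnique_block {K : ℕ} (lam : Fin K → ℝ) (h0 : ∀ j, 0 ≤ lam j) (h1 : ∑ j, lam j = 1)
    (N : ℕ) (v : Fin N) : ∃! j, v ∈ block lam N j := by
  classical
  have hK : 0 < K := by
    rcases Nat.eq_zero_or_pos K with h | h
    · subst h; simp at h1
    · exact h
  let S : Finset (Fin K) :=
    Finset.univ.filter fun j => (v.val : ℝ) + 1 ≤ (N : ℝ) * ∑ k ∈ Finset.Iic j, lam k
  have hv : (v.val : ℝ) + 1 ≤ N := by exact_mod_cast v.2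
  have hS : S.Nonempty := by
    refine ⟨⟨K - 1, by omega⟩, ?_⟩
    have : Finset.Iic (⟨K - 1, by omega⟩ : Fin K) = Finset.univ := by
      ext k; simp only [Finset.mem_Iic, Finset.mem_univ, iff_true, Fin.le_def]; omega
    simp only [S, Finset.mem_filter, Finset.mem_univ, true_and, this, h1, mul_one]
    exact hv
  refine ⟨S.min' hS, ⟨?_, ?_⟩, ?_⟩
  · by_contra hcon
    push Not at hcon
    have hpos : (0 : ℝ) < (v.val : ℝ) + 1 := by positivity
    set j := S.min' hS with hj
    have hj0 : 0 < j.val := by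
      rcases Nat.eq_zero_or_pos j.val with h | h
      · have : Finset.Iio j = ∅ := by
          ext k
          simp only [Finset.mem_Iio, Fin.lt_def, h, Nat.not_lt_zero, Finset.notMem_empty]
        rw [this] at hcon; simp at hcon; linarith
      · exact h
    have hmem : (⟨j.val - 1, by omega⟩ : Fin K) ∈ S := by
      have : Finset.Iic (⟨j.val - 1, by omega⟩ : Fin K) = Finset.Iio j := by
        ext k; simp only [Finset.mem_Iic, Finset.mem_Iio, Fin.le_def, Fin.lt_def]; omega
      simp only [S, Finset.mem_filter, Finset.mem_univ, true_and, this]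
      exact hcon
    have := S.min'_le _ hmem
    rw [← hj, Fin.le_def] at this
    simp at this; omega
  · have := S.min'_mem hS
    simpa only [S, Finset.mem_filter, Finset.mem_univ, true_and] using this
  · rintro j ⟨ha, hb⟩
    have hjS : j ∈ S := by simpa [S] using hb
    refine le_antisymm ?_ (S.min'_le _ hjS)
    by_contra hlt
    push Not at hlt
    have hm := S.min'_mem hS
    simp only [S, Finset.mem_filter, Finset.mem_univ, true_and] at hm
    have hsub : ∑ k ∈ Finset.Iic (S.min' hS), lam k ≤ ∑ k ∈ Finset.Iio j, lam k := by
      apply Finset.sum_le_sum_of_subset_of_nonneg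
      · intro k hk
        simp only [Finset.mem_Iic] at hk
        simpa using lt_of_le_of_lt hk hlt
      · intro k _ _; exact h0 k
    have := mul_le_mul_of_nonneg_left hsub (Nat.cast_nonneg (α := ℝ) N)
    linarith

open Classical in
/-- The probability `θ_{j₁ … j_p}` of the hyperedge `{i₁ < ⋯ < i_p}`, where `i_l ∈ B_{j_l}`.
(Exactly one tuple `j` satisfies this, so that the sum has one nonzero term.) -/
def edgeProb {p K : ℕ} (lam : Fin K → ℝ) (θ : (Fin p → Fin K) → ℝ) {N : ℕ}
    (e : Hyperedge p N) : ℝ :=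
  ∑ j : Fin p → Fin K,
    if ∀ l, e.1.orderEmbOfFin e.2 l ∈ block lam N (j l) then θ j else 0

/-- The Bernoulli law of parameter `q ∈ [0, 1]` on `Bool`. -/
def bernoulliLaw (q : ℝ) : Measure Bool :=
  ENNReal.ofReal q • Measure.dirac true + ENNReal.ofReal (1 - q) • Measure.dirac false

/-- The law of the hypergraph stochastic block model on `N` vertices: the hyperedges are present
independently of each other, with the probabilities `edgeProb`. -/
def law {p K : ℕ} (lam : Fin K → ℝ) (θ : (Fin p → Fin K) → ℝ) (N : ℕ) :
    Measure (Hypergraph p N) :=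
  Measure.pi fun e => bernoulliLaw (edgeProb lam θ e)

/-- The conditional law of the spins, given the hypergraph. -/
def isingKernel (p N : ℕ) (β : ℝ) : Kernel (Hypergraph p N) (Config N) :=
  Kernel.ofFunOfCountable fun G => ising (interaction G) β

/-- The joint law `ℚ_β` of the hypergraph and the spins. -/
def jointLaw {p K : ℕ} (lam : Fin K → ℝ) (θ : (Fin p → Fin K) → ℝ) (N : ℕ) (β : ℝ) :
    Measure (Hypergraph p N × Config N) :=
  law lam θ N ⊗ₘ isingKernel p N β

/-! ### The threshold -/

/-- The binary entropy function `I(t) = ((1+t) log (1+t) + (1-t) log (1-t)) / 2`. -/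
def binEntropy (t : ℝ) : ℝ :=
  1 / 2 * ((1 + t) * Real.log (1 + t) + (1 - t) * Real.log (1 - t))

/-- The mean-field functional `φ_β(t₁, …, t_K)`. -/
def phi {p K : ℕ} (lam : Fin K → ℝ) (θ : (Fin p → Fin K) → ℝ) (β : ℝ) (t : Fin K → ℝ) : ℝ :=
  β * (∑ j : Fin p → Fin K, θ j * ∏ l, (lam (j l) * t (j l))) - ∑ j, lam j * binEntropy (t j)

/-- The threshold `β* = sup {β ≥ 0 : sup_{t ∈ [0,1]^K} φ_β(t) = 0}`, which may be `+∞`. -/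
def betaStar {p K : ℕ} (lam : Fin K → ℝ) (θ : (Fin p → Fin K) → ℝ) : EReal :=
  sSup {c : EReal | ∃ β : ℝ, 0 ≤ β ∧ c = (β : EReal) ∧
    sSup (phi lam θ β '' {t | ∀ j, t j ∈ Set.Icc (0 : ℝ) 1}) = 0}

end

end HSBM

namespace HSBM

/-! ### Elementary inequalities -/

/-! Everything is read off from the size of the normalized partition function `Z_N`, which is
bounded in mean below the threshold and exponentially large above it.

Below the threshold, some larger parameter still has nonpositive mean-field functional, so `β` times
the energy is at most `c` times the entropy with `c < 1` (`exists_energy_le_of_lt_betaStar`).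
Hyperedges are independent and their weights have bounded sum of squares. Hence the exponential
moment of the Hamiltonian at a fixed `x` is, up to a constant factor, the exponential of its mean
(`integral_exp_tensorForm_le`), and this mean is `N` times the energy of the block means, up to a
bounded error (`abs_meanForm_sub_le`). Averaging over `x` leaves a product over blocks of
exponential moments of order `c` of block size times entropy of the block mean, and a Chernoff bound
controls each uniformly in the block size (`sum_exp_binEntropy_le`). So `𝔼 Z_N` is bounded
(`exists_integral_partition_le`). Then `0 ≤ log Z_N ≤ Z_N` bounds the mean free energy. The
divergence is at most the mean free energy at `β₂` (`klDiv_jointLaw_le`). By Fatou, almost surely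
`Z_N` stays bounded along a subsequence, on which an event of small probability at `β₂` cannot have
probability near one at `β₁` (`ising_real_le`), so the two parameters cannot be separated.

Above the threshold, the functional is positive at some `t`. The product measure with mean `t_j` on
block `j`, inserted in the Gibbs variational bound (`le_logPartition`), together with exponential
concentration over the hypergraph and Borel–Cantelli, gives `log Z_N ≥ εN` eventually. This forces
the Hamiltonian to be of order `N` with high probability (`ising_real_hamiltonian_le`). By
Cauchy–Schwarz the local fields then have sum of squares of order `N`, so the pseudo-likelihood
score decreases in the parameter at a rate of order `N` (`le_score_sub`). At the true parameter the
score has second moment `O(N)`, because centred spins are nearly uncorrelated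
(`sum_weight_score_sq_le`). Its zero therefore lies within `O(1/√N)` of the truth
(`exists_mple_eq`). -/

theorem hasDerivAt_tanh (x : ℝ) : HasDerivAt Real.tanh (1 / Real.cosh x ^ 2) x := by
  have h := (Real.hasDerivAt_sinh x).div (Real.hasDerivAt_cosh x) (Real.cosh_pos x).ne'
  have h2 : Real.cosh x * Real.cosh x - Real.sinh x * Real.sinh x = 1 := by
    nlinarith [Real.cosh_sq x]
  rw [h2] at h
  exact h.congr_of_eventuallyEq (Eventually.of_forall fun y => Real.tanh_eq_sinh_div_cosh y)

theorem exists_tanh_sub {x y : ℝ} (hxy : x < y) :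
    ∃ c ∈ Set.Ioo x y, Real.tanh y - Real.tanh x = (y - x) / Real.cosh c ^ 2 := by
  obtain ⟨c, hc, h⟩ := exists_hasDerivAt_eq_slope Real.tanh (fun z => 1 / Real.cosh z ^ 2) hxy
    (fun z _ => (hasDerivAt_tanh z).continuousAt.continuousWithinAt)
    (fun z _ => hasDerivAt_tanh z)
  refine ⟨c, hc, ?_⟩
  have : y - x ≠ 0 := by linarith
  field_simp at h ⊢
  linarith

theorem continuous_tanh : Continuous Real.tanh :=
  continuous_iff_continuousAt.2 fun x => (hasDerivAt_tanh x).continuousAt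

theorem abs_tanh_sub_le (x y : ℝ) : |Real.tanh x - Real.tanh y| ≤ |x - y| := by
  wlog h : y ≤ x generalizing x y
  · rw [abs_sub_comm, abs_sub_comm x y]; exact this y x (by linarith)
  rcases h.eq_or_lt with rfl | h
  · simp
  obtain ⟨c, -, hc⟩ := exists_tanh_sub h
  rw [hc, abs_div, abs_of_pos (by positivity : 0 < Real.cosh c ^ 2)]
  exact div_le_self (abs_nonneg _) (one_le_pow₀ (Real.one_le_cosh c))

/-- A quantitative form of the strict monotonicity of `b ↦ m tanh (b m)` on `[0, R]`. -/
theorem le_mul_tanh_sub {m R a b : ℝ} (hm : |m| ≤ 1) (ha : 0 ≤ a) (hab : a ≤ b) (hb : b ≤ R) :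
    (b - a) * m ^ 2 / Real.cosh R ^ 2 ≤ m * Real.tanh (b * m) - m * Real.tanh (a * m) := by
  wlog h : 0 ≤ m generalizing m
  · have := this (m := -m) (by simpa using hm) (by linarith)
    simpa [Real.tanh_neg] using this
  rw [abs_of_nonneg h] at hm
  rcases hab.eq_or_lt with rfl | hab
  · simp
  rcases h.eq_or_lt with rfl | h
  · simp
  obtain ⟨c, hc, e⟩ := exists_tanh_sub (mul_lt_mul_of_pos_right hab h)
  rw [← mul_sub, e]
  have hc0 : 0 ≤ c := le_trans (by positivity) hc.1.le
  have hcR : c ≤ R := by nlinarith [hc.2]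
  have h1 : Real.cosh c ≤ Real.cosh R := by
    rw [Real.cosh_le_cosh, abs_of_nonneg hc0, abs_of_nonneg (hc0.trans hcR)]; exact hcR
  have h2 : Real.cosh c ^ 2 ≤ Real.cosh R ^ 2 := pow_le_pow_left₀ (Real.cosh_pos c).le h1 2
  have h3 : m * ((b * m - a * m) / Real.cosh c ^ 2) = (b - a) * m ^ 2 / Real.cosh c ^ 2 := by ring
  rw [h3]
  have : 0 ≤ (b - a) * m ^ 2 := mul_nonneg (by linarith) (sq_nonneg m)
  exact div_le_div_of_nonneg_left this (by positivity) h2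

/-- Second-order Taylor remainder. The linear term must have coefficient exactly one, since it
reproduces the mean in the exponential moment bound; only the quadratic term may lose a constant. -/
theorem exp_sub_one_le (y : ℝ) : Real.exp y - 1 ≤ y + y ^ 2 * Real.exp |y| := by
  have h := Complex.norm_exp_sub_sum_le_norm_mul_exp (y : ℂ) 2
  have e : Complex.exp (y : ℂ) - ∑ m ∈ Finset.range 2, (y : ℂ) ^ m / (m.factorial : ℂ)
      = ((Real.exp y - (1 + y) : ℝ) : ℂ) := by
    simp [Finset.sum_range_succ]
  rw [e, Complex.norm_real, Complex.norm_real, Real.norm_eq_abs, Real.norm_eq_abs, sq_abs] at h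
  linarith [le_abs_self (Real.exp y - (1 + y))]

/-- Telescoping: replace one factor at a time, all the others being at most one in absolute value.
-/
theorem abs_prod_sub_prod_le {ι : Type*} (s : Finset ι) (f g : ι → ℝ)
    (hf : ∀ i ∈ s, |f i| ≤ 1) (hg : ∀ i ∈ s, |g i| ≤ 1) :
    |∏ i ∈ s, f i - ∏ i ∈ s, g i| ≤ ∑ i ∈ s, |f i - g i| := by
  classical
  induction s using Finset.induction_on with
  | empty => simp
  | insert a s ha ih =>
    rw [Finset.prod_insert ha, Finset.prod_insert ha, Finset.sum_insert ha]
    have ih := ih (fun i hi => hf i (Finset.mem_insert_of_mem hi))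
      (fun i hi => hg i (Finset.mem_insert_of_mem hi))
    have h1 : |∏ i ∈ s, f i| ≤ 1 := by
      rw [Finset.abs_prod]
      exact Finset.prod_le_one (fun _ _ => abs_nonneg _)
        fun i hi => hf i (Finset.mem_insert_of_mem hi)
    have h2 := hg a (Finset.mem_insert_self a s)
    have e : f a * ∏ i ∈ s, f i - g a * ∏ i ∈ s, g i
        = (f a - g a) * ∏ i ∈ s, f i + g a * (∏ i ∈ s, f i - ∏ i ∈ s, g i) := by ring
    rw [e]
    refine (abs_add_le _ _).trans (add_le_add ?_ ?_)
    · rw [abs_mul]; exact mul_le_of_le_one_right (abs_nonneg _) h1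
    · rw [abs_mul]; exact (mul_le_of_le_one_left (abs_nonneg _) h2).trans ih

theorem binEntropy_neg (t : ℝ) : binEntropy (-t) = binEntropy t := by
  unfold binEntropy
  rw [sub_neg_eq_add, ← sub_eq_add_neg]; ring

theorem binEntropy_abs (t : ℝ) : binEntropy |t| = binEntropy t := by
  rcases abs_choice t with h | h <;> rw [h]
  exact binEntropy_neg t

theorem binEntropy_zero : binEntropy 0 = 0 := by simp [binEntropy]

theorem binEntropy_nonneg {t : ℝ} (ht : |t| ≤ 1) : 0 ≤ binEntropy t := by
  have key : ∀ u : ℝ, 0 ≤ u → u - 1 ≤ u * Real.log u := by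
    intro u hu
    have := InformationTheory.klFun_nonneg hu
    rw [InformationTheory.klFun_apply] at this
    linarith
  have h := abs_le.1 ht
  have h1 := key (1 + t) (by linarith)
  have h2 := key (1 - t) (by linarith)
  unfold binEntropy
  linarith

theorem binEntropy_le_one {t : ℝ} (ht : |t| ≤ 1) : binEntropy t ≤ 1 := by
  have key : ∀ u : ℝ, 0 ≤ u → u * Real.log u ≤ u * (u - 1) := by
    intro u hu
    rcases hu.eq_or_lt with rfl | hu
    · simp
    · exact mul_le_mul_of_nonneg_left (Real.log_le_sub_one_of_pos hu) hu.le
  have h := abs_le.1 ht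
  have h1 := key (1 + t) (by linarith)
  have h2 := key (1 - t) (by linarith)
  -- The two bounds from `log u ≤ u - 1` combine to `t²`.
  unfold binEntropy
  nlinarith

/-! ### Counting tuples -/

theorem sum_prod_pi {p N : ℕ} (g : Fin p → Fin N → ℝ) :
    ∑ i : Fin p → Fin N, ∏ l, g l (i l) = ∏ l, ∑ v, g l v := by
  rw [Finset.prod_univ_sum]; simp

theorem sum_ite_apply_eq {p N : ℕ} (l : Fin p) (v : Fin N) :
    ∑ i : Fin p → Fin N, (if i l = v then (1 : ℝ) else 0) = (N : ℝ) ^ (p - 1) := by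
  have h : ∀ i : Fin p → Fin N, (if i l = v then (1 : ℝ) else 0)
      = ∏ k, if k = l then (if i k = v then (1 : ℝ) else 0) else 1 := by
    intro i; simp [Finset.prod_ite_eq']
  simp_rw [h]
  rw [sum_prod_pi (fun k u => if k = l then (if u = v then (1 : ℝ) else 0) else 1),
    ← Finset.mul_prod_erase _ _ (Finset.mem_univ l)]
  rw [Finset.prod_congr rfl (g := fun _ => (N : ℝ)) (fun k hk => by
    simp [(Finset.mem_erase.1 hk).1])]
  simp

theorem sum_ite_apply_eq_and {p N : ℕ} {l k : Fin p} (hlk : l ≠ k) (v w : Fin N) :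
    ∑ i : Fin p → Fin N, (if i l = v ∧ i k = w then (1 : ℝ) else 0) = (N : ℝ) ^ (p - 2) := by
  have h : ∀ i : Fin p → Fin N, (if i l = v ∧ i k = w then (1 : ℝ) else 0)
      = ∏ r, if r = l then (if i r = v then (1 : ℝ) else 0) else
          if r = k then (if i r = w then (1 : ℝ) else 0) else 1 := by
    intro i
    rw [← Finset.mul_prod_erase _ _ (Finset.mem_univ l),
      ← Finset.mul_prod_erase _ _ (Finset.mem_erase.2 ⟨hlk.symm, Finset.mem_univ k⟩)]
    rw [Finset.prod_eq_one]
    · simp only [if_true, hlk.symm, if_false, mul_one, ite_and]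
      split_ifs <;> simp
    · intro r hr; simp only [Finset.mem_erase] at hr; simp [hr.1, hr.2.1]
  simp_rw [h]
  rw [sum_prod_pi (fun r u => if r = l then (if u = v then (1 : ℝ) else 0) else
          if r = k then (if u = w then (1 : ℝ) else 0) else 1),
    ← Finset.mul_prod_erase _ _ (Finset.mem_univ l),
    ← Finset.mul_prod_erase _ _ (Finset.mem_erase.2 ⟨hlk.symm, Finset.mem_univ k⟩)]
  rw [Finset.prod_congr rfl (g := fun _ => (N : ℝ)) (fun r hr => by
    simp only [Finset.mem_erase] at hr; simp [hr.1, hr.2.1])]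
  simp [hlk.symm, Nat.sub_sub]

/-- The number of tuples with a repeated entry is at most `p² N^{p-1}`. -/
theorem sum_ite_not_injective_le {p N : ℕ} (hp : 2 ≤ p) :
    ∑ i : Fin p → Fin N, (if Function.Injective i then (0 : ℝ) else 1)
      ≤ (p : ℝ) ^ 2 * (N : ℝ) ^ (p - 1) := by
  have h : ∀ i : Fin p → Fin N, (if Function.Injective i then (0 : ℝ) else 1)
      ≤ ∑ l : Fin p, ∑ k : Fin p, ∑ v : Fin N,
          if l ≠ k then (if i l = v ∧ i k = v then (1 : ℝ) else 0) else 0 := by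
    intro i
    have hn : ∀ l k v, (0 : ℝ) ≤
        if l ≠ k then (if i l = v ∧ i k = v then (1 : ℝ) else 0) else 0 := by
      intro l k v; split_ifs <;> norm_num
    split_ifs with hi
    · exact Finset.sum_nonneg fun l _ => Finset.sum_nonneg fun k _ =>
        Finset.sum_nonneg fun v _ => hn l k v
    · simp only [Function.Injective, not_forall] at hi
      obtain ⟨l, k, hlk, hne⟩ := hi
      refine le_trans ?_ (Finset.single_le_sum (fun l _ => Finset.sum_nonneg fun k _ =>
        Finset.sum_nonneg fun v _ => hn l k v) (Finset.mem_univ l))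
      refine le_trans ?_ (Finset.single_le_sum (fun k _ =>
        Finset.sum_nonneg fun v _ => hn l k v) (Finset.mem_univ k))
      refine le_trans ?_ (Finset.single_le_sum (fun v _ => hn l k v) (Finset.mem_univ (i l)))
      simp [hne, hlk]
  refine (Finset.sum_le_sum fun i _ => h i).trans ?_
  rw [Finset.sum_comm]
  have h2 : ∀ l : Fin p, ∑ i : Fin p → Fin N, ∑ k : Fin p, ∑ v : Fin N,
      (if l ≠ k then (if i l = v ∧ i k = v then (1 : ℝ) else 0) else 0)
      ≤ p * (N : ℝ) ^ (p - 1) := by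
    intro l
    rw [Finset.sum_comm]
    have h3 : ∀ k : Fin p, ∑ i : Fin p → Fin N, ∑ v : Fin N,
        (if l ≠ k then (if i l = v ∧ i k = v then (1 : ℝ) else 0) else 0)
        ≤ (N : ℝ) ^ (p - 1) := by
      intro k
      by_cases hlk : l = k
      · simp [hlk]
      · rw [Finset.sum_comm]
        simp only [ne_eq, hlk, not_false_eq_true, if_true]
        rw [Finset.sum_congr rfl fun v _ => sum_ite_apply_eq_and hlk v v]
        simp only [Finset.sum_const, Finset.card_univ, Fintype.card_fin, nsmul_eq_mul]
        rw [← pow_succ', show p - 2 + 1 = p - 1 by omega]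
    refine (Finset.sum_le_sum fun k _ => h3 k).trans ?_
    simp
  refine (Finset.sum_le_sum fun l _ => h2 l).trans ?_
  simp; apply le_of_eq; ring

/-! ### Blocks and hyperedge probabilities -/

theorem exists_blockIndex {K : ℕ} (lam : Fin K → ℝ) (h0 : ∀ j, 0 ≤ lam j) (h1 : ∑ j, lam j = 1)
    (N : ℕ) : ∃ b : Fin N → Fin K, ∀ v j, v ∈ block lam N j ↔ b v = j := by
  choose b hb hu using existsUnique_block lam h0 h1 N
  refine ⟨b, fun v j => ⟨fun h => (hu v j h).symm, ?_⟩⟩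
  rintro rfl
  exact hb v

/-- A block consists of the integers in a half-open interval of length `N λ_j`; their number is a
difference of two floors. -/
theorem abs_card_block_sub_le {K N : ℕ} {lam : Fin K → ℝ} (h0 : ∀ j, 0 ≤ lam j)
    (h1 : ∑ j, lam j = 1) {b : Fin N → Fin K} (hb : ∀ v j, v ∈ block lam N j ↔ b v = j)
    (j : Fin K) : |((Finset.univ.filter fun v => b v = j).card : ℝ) - N * lam j| ≤ 1 := by
  set u := ∑ k ∈ Finset.Iio j, lam k with hu
  set w := ∑ k ∈ Finset.Iic j, lam k with hw
  have huw : w = u + lam j := by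
    rw [hw, hu, ← Finset.Iio_insert, Finset.sum_insert (by simp)]; ring
  have hu0 : 0 ≤ u := Finset.sum_nonneg fun k _ => h0 k
  have hw1 : w ≤ 1 := by
    rw [← h1]; exact Finset.sum_le_sum_of_subset_of_nonneg (Finset.subset_univ _) fun k _ _ => h0 k
  have hj := h0 j
  have hN : (0 : ℝ) ≤ N := Nat.cast_nonneg N
  have hNu : 0 ≤ (N : ℝ) * u := mul_nonneg hN hu0
  have hNw : 0 ≤ (N : ℝ) * w := mul_nonneg hN (by linarith)
  have hcard : (Finset.univ.filter fun v => b v = j).card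
      = (Finset.Ioc ⌊(N : ℝ) * u⌋₊ ⌊(N : ℝ) * w⌋₊).card := by
    refine Finset.card_bij (fun v _ => v.val + 1) ?_ ?_ ?_
    · intro v hv
      simp only [Finset.mem_filter, Finset.mem_univ, true_and, ← hb, block, Set.mem_ofPred_eq] at hv
      rw [Finset.mem_Ioc, Nat.floor_lt hNu, Nat.le_floor_iff hNw]
      push_cast
      exact hv
    · intro v _ v' _ h; ext; omega
    · intro n hn
      rw [Finset.mem_Ioc, Nat.floor_lt hNu, Nat.le_floor_iff hNw] at hn
      have hn0 : 0 < n := by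
        have := hNu.trans_lt hn.1
        exact_mod_cast this
      have hnN : n ≤ N := by
        have : (n : ℝ) ≤ N := hn.2.trans (mul_le_of_le_one_right hN hw1)
        exact_mod_cast this
      have hcast : ((n - 1 : ℕ) : ℝ) + 1 = n := by
        rw [Nat.cast_sub hn0]; simp
      refine ⟨⟨n - 1, by omega⟩, ?_, by simp; omega⟩
      simp only [Finset.mem_filter, Finset.mem_univ, true_and, ← hb, block, Set.mem_ofPred_eq]
      rw [hcast]
      exact hn
  have hle : ⌊(N : ℝ) * u⌋₊ ≤ ⌊(N : ℝ) * w⌋₊ := Nat.floor_le_floor (by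
    rw [huw]; nlinarith)
  rw [hcard, Nat.card_Ioc, Nat.cast_sub hle]
  have a1 := Nat.floor_le hNu
  have a2 := Nat.lt_floor_add_one ((N : ℝ) * u)
  have a3 := Nat.floor_le hNw
  have a4 := Nat.lt_floor_add_one ((N : ℝ) * w)
  have a5 : (N : ℝ) * w = N * u + N * lam j := by rw [huw]; ring
  rw [abs_le]; constructor <;> linarith

theorem edgeProb_eq {p K N : ℕ} {lam : Fin K → ℝ} {b : Fin N → Fin K}
    (hb : ∀ v j, v ∈ block lam N j ↔ b v = j) (θ : (Fin p → Fin K) → ℝ) (e : Hyperedge p N) :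
    edgeProb lam θ e = θ fun l => b (e.1.orderEmbOfFin e.2 l) := by
  classical
  unfold edgeProb
  rw [Finset.sum_eq_single fun l => b (e.1.orderEmbOfFin e.2 l)]
  · rw [if_pos fun l => (hb _ _).2 rfl]
  · intro j _ hj
    rw [if_neg]
    intro h
    exact hj (funext fun l => ((hb _ _).1 (h l)).symm)
  · simp

theorem edgeProb_mem_Icc {p K N : ℕ} {lam : Fin K → ℝ} {b : Fin N → Fin K}
    (hb : ∀ v j, v ∈ block lam N j ↔ b v = j) {θ : (Fin p → Fin K) → ℝ}
    (hθ : ∀ j, θ j ∈ Set.Icc (0 : ℝ) 1) (e : Hyperedge p N) :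
    edgeProb lam θ e ∈ Set.Icc (0 : ℝ) 1 := by
  rw [edgeProb_eq hb]; exact hθ _

theorem card_image_eq_iff {p N : ℕ} (i : Fin p → Fin N) :
    (Finset.univ.image i).card = p ↔ Function.Injective i := by
  constructor
  · intro h
    have h2 : (Finset.univ.image i).card = (Finset.univ : Finset (Fin p)).card := by simpa using h
    have := Finset.card_image_iff.1 h2
    simpa [Set.injOn_univ] using this
  · intro h; rw [Finset.card_image_of_injective _ h]; simp

/-- `edgeProb` reads a hyperedge in increasing order, whereas the adjacency tensor sees all its
orderings. Two orderings differ by a permutation of the slots, which the symmetry of `θ` absorbs. -/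
theorem apply_eq_edgeProb {p K N : ℕ} {lam : Fin K → ℝ} {b : Fin N → Fin K}
    (hb : ∀ v j, v ∈ block lam N j ↔ b v = j) {θ : (Fin p → Fin K) → ℝ}
    (hs : ∀ (σ : Equiv.Perm (Fin p)) (j : Fin p → Fin K), θ (j ∘ σ) = θ j)
    (e : Hyperedge p N) (i : Fin p → Fin N) (hi : Finset.univ.image i = e.1) :
    θ (b ∘ i) = edgeProb lam θ e := by
  have hinj : Function.Injective i := by rw [← card_image_eq_iff, hi, e.2]
  have hmem : ∀ l, i l ∈ e.1 := fun l => by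
    rw [← hi]; exact Finset.mem_image_of_mem _ (Finset.mem_univ l)
  let g : Fin p → Fin p := fun l => (e.1.orderIsoOfFin e.2).symm ⟨i l, hmem l⟩
  have hg : Function.Injective g := by
    intro l k h
    have := (e.1.orderIsoOfFin e.2).symm.injective h
    exact hinj (Subtype.ext_iff.1 this)
  let σ : Equiv.Perm (Fin p) := Equiv.ofBijective g (Finite.injective_iff_bijective.1 hg)
  rw [edgeProb_eq hb, ← hs σ fun l => b (e.1.orderEmbOfFin e.2 l)]
  congr 1
  funext l
  have : (e.1.orderIsoOfFin e.2 (g l) : Fin N) = i l := by simp [g]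
  change b (i l) = b (e.1.orderEmbOfFin e.2 (g l))
  rw [← this, Finset.coe_orderIsoOfFin_apply]

/-! ### The random hypergraph -/

instance isFiniteMeasure_bernoulliLaw (q : ℝ) : IsFiniteMeasure (bernoulliLaw q) := by
  unfold bernoulliLaw
  have h1 : IsFiniteMeasure (ENNReal.ofReal q • Measure.dirac true) :=
    Measure.smul_finite _ ENNReal.ofReal_ne_top
  have h2 : IsFiniteMeasure (ENNReal.ofReal (1 - q) • Measure.dirac false) :=
    Measure.smul_finite _ ENNReal.ofReal_ne_top
  infer_instance

theorem isProbabilityMeasure_bernoulliLaw {q : ℝ} (hq : q ∈ Set.Icc (0 : ℝ) 1) :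
    IsProbabilityMeasure (bernoulliLaw q) := by
  refine ⟨?_⟩
  simp [bernoulliLaw]
  rw [← ENNReal.ofReal_add hq.1 (by linarith [hq.2])]
  simp

theorem integral_bernoulliLaw {q : ℝ} (hq : q ∈ Set.Icc (0 : ℝ) 1) (f : Bool → ℝ) :
    ∫ a, f a ∂bernoulliLaw q = q * f true + (1 - q) * f false := by
  have hi : ∀ (c : ℝ) (a : Bool), Integrable f (ENNReal.ofReal c • Measure.dirac a) := fun c a =>
    (Integrable.of_finite).smul_measure ENNReal.ofReal_ne_top
  rw [bernoulliLaw, integral_add_measure (hi _ _) (hi _ _), integral_smul_measure,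
    integral_smul_measure]
  simp [hq.1, hq.2]

theorem isProbabilityMeasure_law {p K N : ℕ} {lam : Fin K → ℝ} {θ : (Fin p → Fin K) → ℝ}
    {b : Fin N → Fin K} (hb : ∀ v j, v ∈ block lam N j ↔ b v = j)
    (hθ : ∀ j, θ j ∈ Set.Icc (0 : ℝ) 1) : IsProbabilityMeasure (law lam θ N) := by
  have := fun e : Hyperedge p N => isProbabilityMeasure_bernoulliLaw (edgeProb_mem_Icc hb hθ e)
  unfold law
  infer_instance

/-- The contribution of the hyperedge `e` to the `p`-linear form of the complete hypergraph. -/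
noncomputable def edgeWeight {p N : ℕ} (f : Fin N → ℝ) (e : Hyperedge p N) : ℝ :=
  ∑ i : Fin p → Fin N, if Finset.univ.image i = e.1 then (∏ l, f (i l)) / (N : ℝ) ^ (p - 1) else 0

/-- The `p`-linear form of an interaction tensor, on the diagonal. -/
noncomputable def tensorForm {p N : ℕ} (J : Tensor p N) (f : Fin N → ℝ) : ℝ :=
  ∑ i : Fin p → Fin N, J i * ∏ l, f (i l)

/-- The mean of `tensorForm` over the stochastic block model. -/
noncomputable def meanForm {p K N : ℕ} (θ : (Fin p → Fin K) → ℝ) (b : Fin N → Fin K) (f : Fin N → ℝ) : ℝ :=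
  ∑ i : Fin p → Fin N,
    if Function.Injective i then θ (b ∘ i) * ((∏ l, f (i l)) / (N : ℝ) ^ (p - 1)) else 0

theorem sum_edge_ite {p N : ℕ} (i : Fin p → Fin N) (F : Hyperedge p N → ℝ) :
    ∑ e : Hyperedge p N, (if Finset.univ.image i = e.1 then F e else 0)
      = if h : (Finset.univ.image i).card = p then F ⟨Finset.univ.image i, h⟩ else 0 := by
  split_ifs with h
  · rw [Finset.sum_eq_single ⟨Finset.univ.image i, h⟩]
    · simp
    · intro e _ he
      rw [if_neg]
      intro h'
      exact he (Subtype.ext h'.symm)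
    · simp
  · refine Finset.sum_eq_zero fun e _ => if_neg fun h' => h ?_
    rw [h', e.2]

/-- Grouping tuples by their image writes the form as a sum with one term per hyperedge, so that
under the block model the terms are independent. -/
theorem tensorForm_interaction {p N : ℕ} (G : Hypergraph p N) (f : Fin N → ℝ) :
    tensorForm (interaction G) f = ∑ e, if G e then edgeWeight f e else 0 := by
  have h : ∀ e : Hyperedge p N, (if G e then edgeWeight f e else 0) = ∑ i : Fin p → Fin N,
      if Finset.univ.image i = e.1 then
        (if G e then (∏ l, f (i l)) / (N : ℝ) ^ (p - 1) else 0) else 0 := by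
    intro e
    unfold edgeWeight
    split_ifs <;> simp
  simp_rw [h]
  rw [Finset.sum_comm]
  refine Finset.sum_congr rfl fun i _ => ?_
  rw [sum_edge_ite]
  unfold interaction adjTensor
  split_ifs <;> simp [div_eq_inv_mul]

theorem sum_edgeProb_mul_edgeWeight {p K N : ℕ} {lam : Fin K → ℝ} {b : Fin N → Fin K}
    (hb : ∀ v j, v ∈ block lam N j ↔ b v = j) {θ : (Fin p → Fin K) → ℝ}
    (hs : ∀ (σ : Equiv.Perm (Fin p)) (j : Fin p → Fin K), θ (j ∘ σ) = θ j) (f : Fin N → ℝ) :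
    ∑ e : Hyperedge p N, edgeProb lam θ e * edgeWeight f e = meanForm θ b f := by
  have h : ∀ e : Hyperedge p N, edgeProb lam θ e * edgeWeight f e = ∑ i : Fin p → Fin N,
      if Finset.univ.image i = e.1 then
        edgeProb lam θ e * ((∏ l, f (i l)) / (N : ℝ) ^ (p - 1)) else 0 := by
    intro e
    rw [edgeWeight, Finset.mul_sum]
    exact Finset.sum_congr rfl fun i _ => by split_ifs <;> simp
  simp_rw [h]
  rw [Finset.sum_comm]
  refine Finset.sum_congr rfl fun i _ => ?_
  rw [sum_edge_ite]
  by_cases hi : Function.Injective i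
  · rw [dif_pos ((card_image_eq_iff i).2 hi), if_pos hi, 
      apply_eq_edgeProb hb hs ⟨_, (card_image_eq_iff i).2 hi⟩ i rfl]
  · rw [dif_neg fun h => hi ((card_image_eq_iff i).1 h), if_neg hi]

theorem abs_prod_le_one {ι : Type*} (s : Finset ι) (g : ι → ℝ) (hg : ∀ i ∈ s, |g i| ≤ 1) :
    |∏ i ∈ s, g i| ≤ 1 := by
  rw [Finset.abs_prod]
  exact Finset.prod_le_one (fun _ _ => abs_nonneg _) hg

theorem abs_edgeWeight_le {p N : ℕ} {f : Fin N → ℝ} (hf : ∀ v, |f v| ≤ 1)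
    (e : Hyperedge p N) : |edgeWeight f e| ≤
      ∑ i : Fin p → Fin N, if Finset.univ.image i = e.1 then 1 / (N : ℝ) ^ (p - 1) else 0 := by
  refine (Finset.abs_sum_le_sum_abs _ _).trans (Finset.sum_le_sum fun i _ => ?_)
  split_ifs
  · rw [abs_div, abs_of_nonneg (by positivity : (0 : ℝ) ≤ (N : ℝ) ^ (p - 1))]
    gcongr
    exact abs_prod_le_one _ _ fun l _ => hf _
  · simp

theorem abs_edgeWeight_le' {p N : ℕ} {f : Fin N → ℝ} (hf : ∀ v, |f v| ≤ 1)
    (e : Hyperedge p N) : |edgeWeight f e| ≤ (p : ℝ) ^ p / (N : ℝ) ^ (p - 1) := by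
  refine (abs_edgeWeight_le hf e).trans ?_
  rw [← Finset.sum_filter, Finset.sum_const, nsmul_eq_mul, mul_one_div]
  gcongr
  -- Orderings of `e` are counted crudely as all maps from the slots into `e`, hence `p ^ p` in
  -- place of `p!`.
  have hsub : (Finset.univ.filter fun i : Fin p → Fin N => Finset.univ.image i = e.1)
      ⊆ Fintype.piFinset fun _ => e.1 := by
    intro i hi
    simp only [Finset.mem_filter, Finset.mem_univ, true_and] at hi
    rw [Fintype.mem_piFinset]
    intro l
    rw [← hi]
    exact Finset.mem_image_of_mem _ (Finset.mem_univ l)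
  have := Finset.card_le_card hsub
  rw [Fintype.card_piFinset] at this
  simp only [e.2, Finset.prod_const, Finset.card_univ, Fintype.card_fin] at this
  exact_mod_cast this

theorem sum_abs_edgeWeight_le {p N : ℕ} (hp : 2 ≤ p) (hN : 0 < N) {f : Fin N → ℝ}
    (hf : ∀ v, |f v| ≤ 1) : ∑ e : Hyperedge p N, |edgeWeight f e| ≤ N := by
  refine (Finset.sum_le_sum fun e _ => abs_edgeWeight_le hf e).trans ?_
  rw [Finset.sum_comm]
  have h : ∀ i : Fin p → Fin N, ∑ e : Hyperedge p N,
      (if Finset.univ.image i = e.1 then 1 / (N : ℝ) ^ (p - 1) else 0) ≤ 1 / (N : ℝ) ^ (p - 1) := by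
    intro i
    rw [sum_edge_ite i fun _ => 1 / (N : ℝ) ^ (p - 1)]
    split_ifs
    · exact le_rfl
    · positivity
  refine (Finset.sum_le_sum fun i _ => h i).trans ?_
  have hN' : (0 : ℝ) < N := by exact_mod_cast hN
  simp only [Finset.sum_const, Finset.card_univ, Fintype.card_pi, Fintype.card_fin,
    Finset.prod_const, nsmul_eq_mul, Nat.cast_pow]
  rw [mul_one_div, div_le_iff₀ (by positivity), ← pow_succ', show p - 1 + 1 = p by omega]

/-- Largest weight times total weight: `N^{-(p-1)}` against `N`. This is where `p ≥ 2` keeps the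
fluctuations over the hypergraph bounded. -/
theorem sum_edgeWeight_sq_le {p N : ℕ} (hp : 2 ≤ p) (hN : 0 < N) {f : Fin N → ℝ}
    (hf : ∀ v, |f v| ≤ 1) : ∑ e : Hyperedge p N, edgeWeight f e ^ 2 ≤ (p : ℝ) ^ p := by
  have hN' : (0 : ℝ) < N := by exact_mod_cast hN
  have h : ∀ e : Hyperedge p N, edgeWeight f e ^ 2
      ≤ (p : ℝ) ^ p / (N : ℝ) ^ (p - 1) * |edgeWeight f e| := by
    intro e
    rw [← sq_abs, sq]
    exact mul_le_mul_of_nonneg_right (abs_edgeWeight_le' hf e) (abs_nonneg _)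
  refine (Finset.sum_le_sum fun e _ => h e).trans ?_
  rw [← Finset.mul_sum]
  refine (mul_le_mul_of_nonneg_left (sum_abs_edgeWeight_le hp hN hf) (by positivity)).trans ?_
  rw [div_mul_eq_mul_div, div_le_iff₀ (by positivity)]
  gcongr
  exact le_self_pow₀ (by exact_mod_cast hN) (by omega)

/-- The constant in `integral_exp_tensorForm_le`. -/
noncomputable def expConst (p : ℕ) (s : ℝ) : ℝ := s ^ 2 * Real.exp (|s| * (p : ℝ) ^ p) * (p : ℝ) ^ p

/-- Exponential moments of the `p`-linear form of the random hypergraph. -/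
theorem integral_exp_tensorForm_le {p K N : ℕ} (hp : 2 ≤ p) (hN : 0 < N) {lam : Fin K → ℝ}
    {b : Fin N → Fin K} (hb : ∀ v j, v ∈ block lam N j ↔ b v = j) {θ : (Fin p → Fin K) → ℝ}
    (hθ : ∀ j, θ j ∈ Set.Icc (0 : ℝ) 1)
    (hs : ∀ (σ : Equiv.Perm (Fin p)) (j : Fin p → Fin K), θ (j ∘ σ) = θ j)
    {f : Fin N → ℝ} (hf : ∀ v, |f v| ≤ 1) (s : ℝ) :
    ∫ G, Real.exp (s * tensorForm (interaction G) f) ∂law lam θ N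
      ≤ Real.exp (s * meanForm θ b f + expConst p s) := by
  have hN' : (0 : ℝ) < N := by exact_mod_cast hN
  have h1 : ∀ G : Hypergraph p N, Real.exp (s * tensorForm (interaction G) f)
      = ∏ e, Real.exp (s * if G e then edgeWeight f e else 0) := by
    intro G
    rw [tensorForm_interaction, Finset.mul_sum, Real.exp_sum]
  simp_rw [h1]
  rw [law, integral_fintype_prod_eq_prod
    (fun (e : Hyperedge p N) (a : Bool) => Real.exp (s * if a then edgeWeight f e else 0))]
  have h2 : ∀ e : Hyperedge p N, ∫ a, Real.exp (s * if a then edgeWeight f e else 0)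
      ∂bernoulliLaw (edgeProb lam θ e) ≤ Real.exp (s * (edgeProb lam θ e * edgeWeight f e)
        + s ^ 2 * Real.exp (|s| * (p : ℝ) ^ p) * edgeWeight f e ^ 2) := by
    intro e
    have hq := edgeProb_mem_Icc hb hθ e
    rw [integral_bernoulliLaw hq]
    simp only [if_true, Bool.false_eq_true, if_false, mul_zero, Real.exp_zero, mul_one]
    set q := edgeProb lam θ e
    set y := s * edgeWeight f e with hy
    have h3 := exp_sub_one_le y
    have h4 : Real.exp |y| ≤ Real.exp (|s| * (p : ℝ) ^ p) := by
      rw [Real.exp_le_exp, hy, abs_mul]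
      refine mul_le_mul_of_nonneg_left ((abs_edgeWeight_le' hf e).trans ?_) (abs_nonneg s)
      exact div_le_self (by positivity) (one_le_pow₀ (by exact_mod_cast hN))
    -- `1 + u ≤ exp u` turns the Bernoulli moment generating function into an exponential, so that
    -- the product over hyperedges becomes a sum in the exponent.
    have h5 : q * Real.exp y + (1 - q) ≤ Real.exp (q * (Real.exp y - 1)) := by
      have := Real.add_one_le_exp (q * (Real.exp y - 1)); linarith
    refine h5.trans (Real.exp_le_exp.2 ?_)
    have h6 : y ^ 2 * Real.exp |y| ≤ y ^ 2 * Real.exp (|s| * (p : ℝ) ^ p) :=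
      mul_le_mul_of_nonneg_left h4 (sq_nonneg y)
    have h7 : 0 ≤ y ^ 2 * Real.exp (|s| * (p : ℝ) ^ p) := by positivity
    calc q * (Real.exp y - 1) ≤ q * (y + y ^ 2 * Real.exp (|s| * (p : ℝ) ^ p)) :=
          mul_le_mul_of_nonneg_left (by linarith) hq.1
      _ ≤ q * y + y ^ 2 * Real.exp (|s| * (p : ℝ) ^ p) := by
          rw [mul_add]; linarith [mul_le_of_le_one_left h7 hq.2]
      _ = _ := by rw [hy]; ring
  refine (Finset.prod_le_prod (fun e _ => integral_nonneg fun a => (Real.exp_pos _).le)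
    fun e _ => h2 e).trans ?_
  rw [← Real.exp_sum, Real.exp_le_exp, Finset.sum_add_distrib, ← Finset.mul_sum, ← Finset.mul_sum,
    sum_edgeProb_mul_edgeWeight hb hs]
  have := mul_le_mul_of_nonneg_left (sum_edgeWeight_sq_le hp hN hf)
    (by positivity : 0 ≤ s ^ 2 * Real.exp (|s| * (p : ℝ) ^ p))
  unfold expConst
  linarith

/-- The mean-field energy `∑_j θ_j ∏_l λ_{j_l} t_{j_l}`. -/
noncomputable def energy {p K : ℕ} (lam : Fin K → ℝ) (θ : (Fin p → Fin K) → ℝ) (t : Fin K → ℝ) : ℝ :=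
  ∑ j : Fin p → Fin K, θ j * ∏ l, (lam (j l) * t (j l))

/-- The mean of the `p`-linear form depends on `f` only through its block averages, up to a
bounded error. -/
theorem abs_meanForm_sub_le {p K N : ℕ} (hp : 2 ≤ p) (hN : 0 < N) {lam : Fin K → ℝ}
    (h0 : ∀ j, 0 ≤ lam j) (h1 : ∑ j, lam j = 1)
    {b : Fin N → Fin K} (hb : ∀ v j, v ∈ block lam N j ↔ b v = j) {θ : (Fin p → Fin K) → ℝ}
    (hθ : ∀ j, θ j ∈ Set.Icc (0 : ℝ) 1) {f : Fin N → ℝ} (hf : ∀ v, |f v| ≤ 1)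
    {t : Fin K → ℝ} (ht : ∀ j, |t j| ≤ 1)
    (hft : ∀ j, ∑ v with b v = j, f v = ((Finset.univ.filter fun v => b v = j).card : ℝ) * t j) :
    |meanForm θ b f - N * energy lam θ t| ≤ (p : ℝ) ^ 2 + (K : ℝ) ^ p * p := by
  have hN' : (0 : ℝ) < N := by exact_mod_cast hN
  set D : ℝ := (N : ℝ) ^ (p - 1) with hD
  have hDpos : 0 < D := by positivity
  have hθ1 : ∀ j, |θ j| ≤ 1 := fun j => by rw [abs_of_nonneg (hθ j).1]; exact (hθ j).2
  set full : ℝ := ∑ i : Fin p → Fin N, θ (b ∘ i) * ((∏ l, f (i l)) / D) with hfull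
  have hA : |meanForm θ b f - full| ≤ (p : ℝ) ^ 2 := by
    have : |meanForm θ b f - full|
        ≤ ∑ i : Fin p → Fin N, (if Function.Injective i then (0 : ℝ) else 1) * (1 / D) := by
      rw [meanForm, hfull, ← Finset.sum_sub_distrib]
      refine (Finset.abs_sum_le_sum_abs _ _).trans (Finset.sum_le_sum fun i _ => ?_)
      split_ifs
      · simp [hD]
      · rw [zero_sub, abs_neg, abs_mul, abs_div, abs_of_pos hDpos, one_mul]
        have h2 : |∏ l, f (i l)| / D ≤ 1 / D := by
          gcongr; exact abs_prod_le_one _ _ fun l _ => hf _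
        exact (mul_le_of_le_one_left (by positivity) (hθ1 _)).trans h2
    refine this.trans ?_
    rw [← Finset.sum_mul, mul_one_div, div_le_iff₀ hDpos]
    exact sum_ite_not_injective_le hp
  -- With repeated indices restored, the sum over tuples with prescribed block labels factorizes
  -- into block sums of `f`.
  have hB : full = N * ∑ j : Fin p → Fin K, θ j * ∏ l, ((∑ v with b v = j l, f v) / N) := by
    have hgroup : ∀ i : Fin p → Fin N, θ (b ∘ i) * ((∏ l, f (i l)) / D)
        = ∑ j : Fin p → Fin K, θ j * ((∏ l, if b (i l) = j l then f (i l) else 0) / D) := by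
      intro i
      rw [Finset.sum_eq_single (b ∘ i)]
      · simp
      · intro j _ hj
        obtain ⟨l, hl⟩ := Function.ne_iff.1 hj
        rw [Finset.prod_eq_zero (Finset.mem_univ l)]
        · simp
        · rw [if_neg]; exact fun h => hl h.symm
      · simp
    rw [hfull]
    simp_rw [hgroup]
    rw [Finset.sum_comm, Finset.mul_sum]
    refine Finset.sum_congr rfl fun j _ => ?_
    rw [← Finset.mul_sum, ← Finset.sum_div,
      sum_prod_pi fun l v => if b v = j l then f v else 0, Finset.prod_div_distrib]
    simp only [Finset.prod_const, Finset.card_univ, Fintype.card_fin, Finset.sum_filter]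
    have : (N : ℝ) ^ p = N * D := by rw [hD, ← pow_succ', show p - 1 + 1 = p by omega]
    rw [this]
    field_simp
  have hcardN : ∀ j, ((Finset.univ.filter fun v => b v = j).card : ℝ) ≤ N := by
    intro j
    have := Finset.card_le_univ (Finset.univ.filter fun v => b v = j)
    rw [Fintype.card_fin] at this
    exact_mod_cast this
  have hlam1 : ∀ j, lam j ≤ 1 := fun j => by
    rw [← h1]; exact Finset.single_le_sum (fun k _ => h0 k) (Finset.mem_univ j)
  -- Replacing a relative block size by `λ_j` costs `1/N` in each of the `p` factors. There are `K ^
  -- p` label tuples, and the prefactor `N` cancels the `1/N`.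
  have hC : |full - N * energy lam θ t| ≤ (K : ℝ) ^ p * p := by
    rw [hB, energy, ← mul_sub, ← Finset.sum_sub_distrib, abs_mul, abs_of_pos hN']
    have hj : ∀ j : Fin p → Fin K, |θ j * ∏ l, ((∑ v with b v = j l, f v) / N)
        - θ j * ∏ l, (lam (j l) * t (j l))| ≤ p * (1 / N) := by
      intro j
      rw [← mul_sub, abs_mul]
      refine (mul_le_of_le_one_left (abs_nonneg _) (hθ1 j)).trans ?_
      refine (abs_prod_sub_prod_le _ _ _ ?_ ?_).trans ?_
      · intro l _
        rw [hft, abs_div, abs_mul, Nat.abs_cast, Nat.abs_cast, div_le_one hN']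
        exact (mul_le_of_le_one_right (by positivity) (ht _)).trans (hcardN _)
      · intro l _
        rw [abs_mul, abs_of_nonneg (h0 _)]
        exact mul_le_one₀ (hlam1 _) (abs_nonneg _) (ht _)
      · refine (Finset.sum_le_sum (g := fun _ => 1 / (N : ℝ)) fun l _ => ?_).trans (by simp)
        have e : (∑ v with b v = j l, f v) / N - lam (j l) * t (j l)
            = (((Finset.univ.filter fun v => b v = j l).card : ℝ) - N * lam (j l)) / N * t (j l) := by
          rw [hft]; field_simp
        rw [e, abs_mul, abs_div, Nat.abs_cast]
        refine (mul_le_of_le_one_right (by positivity) (ht _)).trans ?_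
        gcongr
        exact abs_card_block_sub_le h0 h1 hb _
    have := (Finset.abs_sum_le_sum_abs _ _).trans
      (Finset.sum_le_sum fun j (_ : j ∈ Finset.univ) => hj j)
    refine (mul_le_mul_of_nonneg_left this hN'.le).trans ?_
    simp only [Finset.sum_const, Finset.card_univ, Fintype.card_pi, Fintype.card_fin,
      Finset.prod_const, nsmul_eq_mul, Nat.cast_pow]
    apply le_of_eq
    field_simp
  calc |meanForm θ b f - N * energy lam θ t|
      = |(meanForm θ b f - full) + (full - N * energy lam θ t)| := by congr 1; ring
    _ ≤ _ := (abs_add_le _ _).trans (add_le_add hA hC)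

/-! ### Sums over spin configurations -/

theorem spin_one : spin 1 = 1 := by simp [spin]

theorem spin_neg (s : ℤˣ) : spin (-s) = -spin s := by simp [spin]

theorem spin_eq_or (s : ℤˣ) : spin s = 1 ∨ spin s = -1 := by
  rcases Int.units_eq_one_or s with rfl | rfl
  · exact Or.inl spin_one
  · exact Or.inr (by rw [spin_neg, spin_one])

theorem abs_spin (s : ℤˣ) : |spin s| = 1 := by
  rcases spin_eq_or s with h | h <;> simp [h]

theorem spin_mul_self (s : ℤˣ) : spin s * spin s = 1 := by
  rcases spin_eq_or s with h | h <;> simp [h]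

theorem sum_spin (g : ℤˣ → ℝ) : ∑ s, g s = g 1 + g (-1) := by
  have : (Finset.univ : Finset ℤˣ) = {1, -1} := rfl
  rw [this, Finset.sum_pair (by decide)]

theorem sum_prod_spin {ι : Type*} [Fintype ι] [DecidableEq ι] (g : ι → ℤˣ → ℝ) :
    ∑ x : ι → ℤˣ, ∏ v, g v (x v) = ∏ v, (g v 1 + g v (-1)) := by
  simp_rw [← sum_spin]
  rw [Finset.prod_univ_sum, Fintype.piFinset_univ]

/-! ### Large deviations for the mean of independent fair spins. -/

section Chernoff

variable {ι : Type*} [Fintype ι]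

/-- The average of the spins of a configuration. -/
noncomputable def meanSpin (y : ι → ℤˣ) : ℝ := (∑ v, spin (y v)) / Fintype.card ι

theorem card_mul_meanSpin (y : ι → ℤˣ) : Fintype.card ι * meanSpin y = ∑ v, spin (y v) := by
  rcases isEmpty_or_nonempty ι with h | h
  · simp
  · unfold meanSpin
    have : (Fintype.card ι : ℝ) ≠ 0 := by exact_mod_cast Fintype.card_ne_zero
    field_simp

theorem abs_meanSpin_le (y : ι → ℤˣ) : |meanSpin y| ≤ 1 := by
  rw [meanSpin, abs_div, Nat.abs_cast]
  refine div_le_one_of_le₀ ?_ (by positivity)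
  refine (Finset.abs_sum_le_sum_abs _ _).trans ?_
  simp [abs_spin]

theorem meanSpin_neg (y : ι → ℤˣ) : meanSpin (-y) = -meanSpin y := by
  simp [meanSpin, spin_neg, neg_div]

/-- The likelihood of independent spins of mean `a`, at a configuration whose mean is
at least `a`. -/
theorem exp_card_mul_binEntropy_le {a : ℝ} (ha0 : 0 ≤ a) {y : ι → ℤˣ} (hay : a ≤ meanSpin y) :
    Real.exp (Fintype.card ι * binEntropy a) ≤ ∏ v, (1 + a * spin (y v)) := by
  have hs1 := (abs_le.1 (abs_meanSpin_le y)).2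
  have hsum := card_mul_meanSpin y
  -- At `a = 1` the factors may vanish and logarithms are unavailable, but then every spin equals
  -- one and the product is an explicit power of two.
  rcases (hay.trans hs1).eq_or_lt with rfl | ha1
  · have hs : meanSpin y = 1 := le_antisymm hs1 hay
    rw [hs, mul_one] at hsum
    have hall : ∀ v, spin (y v) = 1 := by
      by_contra! hcon
      obtain ⟨v, hv⟩ := hcon
      have hlt : ∑ v, spin (y v) < ∑ _v : ι, (1 : ℝ) :=
        Finset.sum_lt_sum (fun u _ => (le_abs_self _).trans (abs_spin _).le)
          ⟨v, Finset.mem_univ v, ((le_abs_self _).trans (abs_spin _).le).lt_of_ne hv⟩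
      rw [← hsum] at hlt
      simp at hlt
    simp_rw [hall]
    have : binEntropy 1 = Real.log 2 := by
      norm_num [binEntropy]; ring
    rw [this, Real.exp_nat_mul, Real.exp_log (by norm_num)]
    norm_num
  · have hpos : ∀ v, 0 < 1 + a * spin (y v) := by
      intro v
      rcases spin_eq_or (y v) with h | h <;> rw [h] <;> linarith
    rw [← Real.le_log_iff_exp_le (Finset.prod_pos fun v _ => hpos v),
      Real.log_prod fun v _ => (hpos v).ne']
    -- On `{-1, 1}` every function is affine, so the log-likelihood depends on the configuration
    -- only through its mean, with nonnegative slope.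
    have hlog : ∀ v, Real.log (1 + a * spin (y v))
        = (Real.log (1 + a) + Real.log (1 - a)) / 2
          + (Real.log (1 + a) - Real.log (1 - a)) / 2 * spin (y v) := by
      intro v
      rcases spin_eq_or (y v) with h | h <;> rw [h]
      · rw [mul_one]; ring
      · rw [mul_neg_one, ← sub_eq_add_neg]; ring
    simp_rw [hlog]
    rw [Finset.sum_add_distrib, ← Finset.mul_sum, ← hsum]
    simp only [Finset.sum_const, Finset.card_univ, nsmul_eq_mul]
    have hd : Real.log (1 - a) ≤ Real.log (1 + a) := Real.log_le_log (by linarith) (by linarith)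
    have hn : (0 : ℝ) ≤ Fintype.card ι := Nat.cast_nonneg _
    have := mul_nonneg (mul_nonneg hn (sub_nonneg.2 hay)) (sub_nonneg.2 hd)
    unfold binEntropy
    nlinarith

variable [DecidableEq ι]

/-- Chernoff with a single tilt: take the configuration of smallest mean in the set and tilt by that
mean. Every member of the set has tilted likelihood at least `exp u`, while the likelihoods sum to
`2^n`. No union over the possible means is needed, so no polynomial factor is lost. -/
theorem card_filter_binEntropy_nonneg_le (u : ℝ) :
    (((Finset.univ : Finset (ι → ℤˣ)).filter fun y =>
      u ≤ Fintype.card ι * binEntropy (meanSpin y) ∧ 0 ≤ meanSpin y).card : ℝ)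
      ≤ 2 ^ Fintype.card ι * Real.exp (-u) := by
  set S := (Finset.univ : Finset (ι → ℤˣ)).filter fun y =>
      u ≤ Fintype.card ι * binEntropy (meanSpin y) ∧ 0 ≤ meanSpin y with hS
  rcases S.eq_empty_or_nonempty with h | h
  · rw [h]; simp; positivity
  obtain ⟨z, hz, hmin⟩ := S.exists_min_image meanSpin h
  have hz' := (Finset.mem_filter.1 hz).2
  have hnn : ∀ y : ι → ℤˣ, 0 ≤ ∏ v, (1 + meanSpin z * spin (y v)) := by
    intro y
    refine Finset.prod_nonneg fun v _ => ?_
    have := (abs_le.1 (abs_meanSpin_le z)).2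
    rcases spin_eq_or (y v) with h | h <;> rw [h] <;> linarith [hz'.2]
  have h1 : ∑ y : ι → ℤˣ, ∏ v, (1 + meanSpin z * spin (y v)) = 2 ^ Fintype.card ι := by
    rw [sum_prod_spin fun _ s => 1 + meanSpin z * spin s]
    simp only [spin_neg, spin_one, Finset.prod_const, Finset.card_univ]
    congr 1; ring
  have h2 : (S.card : ℝ) * Real.exp u ≤ 2 ^ Fintype.card ι := by
    rw [← h1, ← nsmul_eq_mul, ← Finset.sum_const]
    refine (Finset.sum_le_sum fun y hy => ?_).trans
      (Finset.sum_le_sum_of_subset_of_nonneg (Finset.subset_univ S) fun y _ _ => hnn y)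
    exact (Real.exp_le_exp.2 hz'.1).trans (exp_card_mul_binEntropy_le hz'.2 (hmin y hy))
  rw [Real.exp_neg, ← div_eq_mul_inv, le_div_iff₀ (Real.exp_pos u)]
  exact h2

theorem card_filter_binEntropy_le (u : ℝ) :
    (((Finset.univ : Finset (ι → ℤˣ)).filter fun y =>
      u ≤ Fintype.card ι * binEntropy (meanSpin y)).card : ℝ)
      ≤ 2 * (2 ^ Fintype.card ι * Real.exp (-u)) := by
  have h := card_filter_binEntropy_nonneg_le (ι := ι) u
  set S := (Finset.univ : Finset (ι → ℤˣ)).filter fun y =>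
      u ≤ Fintype.card ι * binEntropy (meanSpin y) ∧ 0 ≤ meanSpin y with hS
  have hsub : ((Finset.univ : Finset (ι → ℤˣ)).filter fun y =>
      u ≤ Fintype.card ι * binEntropy (meanSpin y)) ⊆ S ∪ S.image fun y => -y := by
    intro y hy
    have hy := (Finset.mem_filter.1 hy).2
    rw [Finset.mem_union]
    rcases le_total 0 (meanSpin y) with h0 | h0
    · exact Or.inl (Finset.mem_filter.2 ⟨Finset.mem_univ _, hy, h0⟩)
    · refine Or.inr (Finset.mem_image.2 ⟨-y, Finset.mem_filter.2 ⟨Finset.mem_univ _, ?_, ?_⟩, ?_⟩)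
      · rwa [meanSpin_neg, binEntropy_neg]
      · rw [meanSpin_neg]; linarith
      · simp
  have hc := (Finset.card_le_card hsub).trans (Finset.card_union_le _ _)
  have hc2 : (S.image fun y => -y).card ≤ S.card := Finset.card_image_le
  have hc3 := hc.trans (Nat.add_le_add_left hc2 _)
  have hc4 : (((Finset.univ : Finset (ι → ℤˣ)).filter fun y =>
      u ≤ Fintype.card ι * binEntropy (meanSpin y)).card : ℝ) ≤ S.card + S.card := by
    exact_mod_cast hc3
  linarith

/-- The constant in `sum_exp_binEntropy_le`. -/
noncomputable def entropyConst (c : ℝ) : ℝ := 2 * Real.exp c / (1 - Real.exp (c - 1))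

/-- The exponential moments of order `c < 1` of `n I(X̄)`, with `X̄` the mean of `n` fair spins,
are bounded uniformly in `n`. -/
theorem sum_exp_binEntropy_le {c : ℝ} (hc0 : 0 ≤ c) (hc1 : c < 1) :
    ∑ y : ι → ℤˣ, Real.exp (c * (Fintype.card ι * binEntropy (meanSpin y)))
      ≤ 2 ^ Fintype.card ι * entropyConst c := by
  set V : (ι → ℤˣ) → ℝ := fun y => Fintype.card ι * binEntropy (meanSpin y) with hV
  have hV0 : ∀ y, 0 ≤ V y := fun y =>
    mul_nonneg (Nat.cast_nonneg _) (binEntropy_nonneg (abs_meanSpin_le y))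
  have hVn : ∀ y, V y ≤ Fintype.card ι := fun y =>
    mul_le_of_le_one_right (Nat.cast_nonneg _) (binEntropy_le_one (abs_meanSpin_le y))
  set M := Fintype.card ι + 1 with hM
  -- Layer cake over integer levels: the term `k = ⌊V y⌋` alone dominates the left side. Level sets
  -- decay like `exp (-k)` and `c < 1`, so the sum over `k` is geometric.
  have hpt : ∀ y, Real.exp (c * V y) ≤ ∑ k ∈ Finset.range M,
      if (k : ℝ) ≤ V y then Real.exp (c * (k + 1)) else 0 := by
    intro y
    have hk : ⌊V y⌋₊ ∈ Finset.range M := by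
      rw [Finset.mem_range, hM, Nat.lt_succ_iff]
      exact Nat.floor_le_of_le (hVn y)
    refine le_trans ?_ (Finset.single_le_sum (fun k _ => ?_) hk)
    · rw [if_pos (Nat.floor_le (hV0 y)), Real.exp_le_exp]
      exact mul_le_mul_of_nonneg_left (Nat.lt_floor_add_one _).le hc0
    · split_ifs <;> positivity
  refine (Finset.sum_le_sum fun y _ => hpt y).trans ?_
  rw [Finset.sum_comm]
  have hk : ∀ k : ℕ, ∑ y : ι → ℤˣ, (if (k : ℝ) ≤ V y then Real.exp (c * (k + 1)) else 0)
      ≤ 2 ^ Fintype.card ι * (2 * Real.exp c) * Real.exp (c - 1) ^ k := by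
    intro k
    rw [← Finset.sum_filter, Finset.sum_const, nsmul_eq_mul]
    refine (mul_le_mul_of_nonneg_right (card_filter_binEntropy_le _) (Real.exp_pos _).le).trans ?_
    have e1 : Real.exp (c * (k + 1)) = Real.exp c * Real.exp (c * k) := by
      rw [← Real.exp_add]; congr 1; ring
    have e2 : Real.exp (c - 1) ^ k = Real.exp (-(k : ℝ)) * Real.exp (c * k) := by
      rw [← Real.exp_nat_mul, ← Real.exp_add]; congr 1; ring
    rw [e1, e2]
    apply le_of_eq; ring
  refine (Finset.sum_le_sum fun k _ => hk k).trans ?_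
  rw [← Finset.mul_sum, entropyConst]
  have hr : Real.exp (c - 1) < 1 := 
    (Real.exp_lt_exp.2 (by linarith : c - 1 < 0)).trans_eq Real.exp_zero
  have e : (2 : ℝ) ^ Fintype.card ι * (2 * Real.exp c / (1 - Real.exp (c - 1)))
      = 2 ^ Fintype.card ι * (2 * Real.exp c) * (1 / (1 - Real.exp (c - 1))) := by ring
  rw [e, geom_sum_eq hr.ne]
  refine mul_le_mul_of_nonneg_left ?_ (by positivity)
  rw [← neg_div_neg_eq, neg_sub, neg_sub, div_le_div_iff_of_pos_right (by linarith)]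
  linarith [pow_pos (Real.exp_pos (c - 1)) M]

end Chernoff

/-- A configuration is the same as a family of configurations on the fibres of `b`; under uniform
spins the blocks are independent. -/
theorem sum_prod_config_fiber {N K : ℕ} (b : Fin N → Fin K)
    (F : (j : Fin K) → ({v // b v = j} → ℤˣ) → ℝ) :
    ∑ x : Config N, ∏ j, F j (fun v => x v.1) = ∏ j, ∑ y, F j y := by
  rw [Finset.prod_univ_sum, Fintype.piFinset_univ]
  let E : Config N ≃ ((j : Fin K) → {v // b v = j} → ℤˣ) :=
    { toFun := fun x j v => x v.1
      invFun := fun y v => y (b v) ⟨v, rfl⟩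
      left_inv := fun x => rfl
      right_inv := fun y => by
        funext j v
        obtain ⟨v, rfl⟩ := v
        rfl }
  exact Fintype.sum_equiv E _ _ fun x => rfl

/-- The mean of the spins in the block `j`. -/
noncomputable def blockMean {N K : ℕ} (b : Fin N → Fin K) (x : Config N) (j : Fin K) : ℝ :=
  meanSpin fun v : {v // b v = j} => x v.1

theorem card_mul_blockMean {N K : ℕ} (b : Fin N → Fin K) (x : Config N) (j : Fin K) :
    ∑ v with b v = j, spin (x v)
      = ((Finset.univ.filter fun v => b v = j).card : ℝ) * blockMean b x j := by
  rw [blockMean, ← Fintype.card_subtype, card_mul_meanSpin]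
  exact (Finset.sum_subtype _ (by simp) fun v => spin (x v))

theorem sum_exp_blockMean_le {N K : ℕ} (b : Fin N → Fin K) {c : ℝ} (hc0 : 0 ≤ c) (hc1 : c < 1) :
    ∑ x : Config N, Real.exp (c * ∑ j,
      ((Finset.univ.filter fun v => b v = j).card : ℝ) * binEntropy (blockMean b x j))
      ≤ 2 ^ N * entropyConst c ^ K := by
  have h : ∀ x : Config N, Real.exp (c * ∑ j,
      ((Finset.univ.filter fun v => b v = j).card : ℝ) * binEntropy (blockMean b x j))
      = ∏ j, Real.exp (c * (Fintype.card {v // b v = j} *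
          binEntropy (meanSpin fun v : {v // b v = j} => x v.1))) := by
    intro x
    rw [Finset.mul_sum, Real.exp_sum]
    simp only [Fintype.card_subtype, blockMean]
  simp_rw [h]
  rw [sum_prod_config_fiber b fun j y =>
    Real.exp (c * (Fintype.card {v // b v = j} * binEntropy (meanSpin y)))]
  refine (Finset.prod_le_prod (fun j _ => Finset.sum_nonneg fun y _ => (Real.exp_pos _).le)
    fun j _ => sum_exp_binEntropy_le hc0 hc1).trans ?_
  rw [Finset.prod_mul_distrib, Finset.prod_pow_eq_pow_sum]
  have : ∑ j, Fintype.card {v // b v = j} = N := by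
    simp_rw [Fintype.card_subtype]
    rw [← Finset.card_eq_sum_card_fiberwise (fun v _ => Finset.mem_univ (b v))]
    simp
  rw [this]
  simp

/-! ### The Ising measure -/

section Ising

variable {p N : ℕ} (J : Tensor p N) (β : ℝ)

/-- The mass function of the Ising model. -/
noncomputable def weight (x : Config N) : ℝ :=
  Real.exp (β * hamiltonian J x) / (2 ^ N * partition J β)

theorem partition_pos : 0 < partition J β := by
  unfold partition
  have : 0 < ∑ x : Config N, Real.exp (β * hamiltonian J x) :=
    Finset.sum_pos (fun x _ => Real.exp_pos _) Finset.univ_nonempty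
  positivity

theorem two_pow_mul_partition :
    2 ^ N * partition J β = ∑ x : Config N, Real.exp (β * hamiltonian J x) := by
  unfold partition
  field_simp

theorem weight_nonneg (x : Config N) : 0 ≤ weight J β x := by
  have := partition_pos J β
  unfold weight; positivity

theorem sum_weight : ∑ x, weight J β x = 1 := by
  have := partition_pos J β
  unfold weight
  rw [← Finset.sum_div, ← two_pow_mul_partition]
  exact div_self (by positivity)

theorem integral_ising (f : Config N → ℝ) : ∫ x, f x ∂ising J β = ∑ x, weight J β x * f x := by
  unfold ising
  rw [integral_finsetSum_measure fun x _ =>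
    (Integrable.of_finite).smul_measure ENNReal.ofReal_ne_top]
  refine Finset.sum_congr rfl fun x _ => ?_
  rw [integral_smul_measure, integral_dirac]
  exact congrArg (· * f x) (ENNReal.toReal_ofReal (weight_nonneg J β x))

theorem ising_apply (S : Set (Config N)) [DecidablePred (· ∈ S)] :
    ising J β S = ∑ x with x ∈ S, ENNReal.ofReal (weight J β x) := by
  unfold ising
  rw [Measure.finsetSum_apply, Finset.sum_filter]
  refine Finset.sum_congr rfl fun x _ => ?_
  rw [Measure.smul_apply, Measure.dirac_apply' _ (Set.toFinite S).measurableSet]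
  by_cases h : x ∈ S <;> simp [h, weight]

theorem ising_real (S : Set (Config N)) [DecidablePred (· ∈ S)] :
    (ising J β).real S = ∑ x with x ∈ S, weight J β x := by
  rw [measureReal_def, ising_apply, ← ENNReal.ofReal_sum_of_nonneg fun x _ => weight_nonneg J β x,
    ENNReal.toReal_ofReal (Finset.sum_nonneg fun x _ => weight_nonneg J β x)]

instance isProbabilityMeasure_ising : IsProbabilityMeasure (ising J β) := by
  classical
  refine ⟨?_⟩
  rw [ising_apply, ← ENNReal.ofReal_sum_of_nonneg fun x _ => weight_nonneg J β x]
  simp [sum_weight]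

theorem ising_singleton (x : Config N) : ising J β {x} = ENNReal.ofReal (weight J β x) := by
  classical
  rw [ising_apply]
  simp [Finset.filter_eq']

end Ising

/-! ### The Gibbs variational lower bound -/

section Gibbs

variable {p N : ℕ}

theorem interaction_eq_zero {G : Hypergraph p N} {i : Fin p → Fin N}
    (hi : ¬ Function.Injective i) : interaction G i = 0 := by
  unfold interaction adjTensor
  rw [dif_neg fun h => hi ((card_image_eq_iff i).1 h), zero_div]

theorem sum_prod_one_add (t : Fin N → ℝ) :
    ∑ x : Config N, ∏ v, (1 + t v * spin (x v)) = 2 ^ N := by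
  rw [sum_prod_spin fun v s => 1 + t v * spin s]
  rw [Finset.prod_congr rfl (g := fun _ => (2 : ℝ))]
  · simp
  · intro v _; rw [spin_neg, spin_one]; ring

/-- The products are `2^N` times the law of independent spins with means `t_v`. Under that law a
monomial in distinct spins has the product of the means as expectation, hence the condition on
non-injective tuples. -/
theorem sum_prod_one_add_mul_hamiltonian {J : Tensor p N}
    (hJ : ∀ i, ¬ Function.Injective i → J i = 0) (t : Fin N → ℝ) :
    ∑ x : Config N, (∏ v, (1 + t v * spin (x v))) * hamiltonian J x
      = 2 ^ N * tensorForm J t := by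
  unfold hamiltonian tensorForm
  simp_rw [Finset.mul_sum]
  rw [Finset.sum_comm]
  refine Finset.sum_congr rfl fun i _ => ?_
  by_cases hi : Function.Injective i
  · have himg : ∀ g : Fin N → ℝ, ∏ l, g (i l)
        = ∏ v, if v ∈ Finset.univ.image i then g v else 1 := by
      intro g
      rw [Finset.prod_ite_mem, Finset.univ_inter, Finset.prod_image fun _ _ _ _ h => hi h]
    have h : ∀ x : Config N, (∏ v, (1 + t v * spin (x v))) * (J i * ∏ l, spin (x (i l)))
        = J i * ∏ v, (1 + t v * spin (x v)) *
            if v ∈ Finset.univ.image i then spin (x v) else 1 := by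
      intro x
      rw [himg fun v => spin (x v), Finset.prod_mul_distrib]; ring
    simp_rw [h]
    rw [← Finset.mul_sum, sum_prod_spin fun v s => (1 + t v * spin s) *
            if v ∈ Finset.univ.image i then spin s else 1, himg t, mul_left_comm]
    congr 1
    have h2 : (2 : ℝ) ^ N = ∏ _v : Fin N, 2 := by simp
    rw [h2, ← Finset.prod_mul_distrib]
    refine Finset.prod_congr rfl fun v _ => ?_
    rw [spin_neg, spin_one]
    split_ifs <;> ring
  · simp [hJ i hi]

/-- The relative entropy of a product measure with respect to the uniform one is additive over the
vertices. -/
theorem sum_prod_one_add_mul_log (t : Fin N → ℝ) :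
    ∑ x : Config N, (∏ v, (1 + t v * spin (x v))) * Real.log (∏ v, (1 + t v * spin (x v)))
      = 2 ^ N * ∑ v, binEntropy (t v) := by
  have h : ∀ x : Config N,
      (∏ v, (1 + t v * spin (x v))) * Real.log (∏ v, (1 + t v * spin (x v)))
      = ∑ u, ∏ v, (1 + t v * spin (x v)) *
          if v = u then Real.log (1 + t v * spin (x v)) else 1 := by
    intro x
    have h2 : ∀ u, ∏ v, (1 + t v * spin (x v)) *
          (if v = u then Real.log (1 + t v * spin (x v)) else 1)
        = (∏ v, (1 + t v * spin (x v))) * Real.log (1 + t u * spin (x u)) := by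
      intro u
      rw [Finset.prod_mul_distrib]
      simp
    simp_rw [h2]
    rw [← Finset.mul_sum]
    by_cases h0 : ∃ v, 1 + t v * spin (x v) = 0
    · obtain ⟨v, hv⟩ := h0
      rw [Finset.prod_eq_zero (Finset.mem_univ v) hv]; simp
    · rw [Real.log_prod fun v _ hv => h0 ⟨v, hv⟩]
  simp_rw [h]
  rw [Finset.sum_comm, Finset.mul_sum]
  refine Finset.sum_congr rfl fun u _ => ?_
  rw [sum_prod_spin fun v s => (1 + t v * spin s) *
    if v = u then Real.log (1 + t v * spin s) else 1]
  have h2 : (2 : ℝ) ^ N = ∏ _v : Fin N, 2 := by simp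
  have h3 : binEntropy (t u) = ∏ v, if v = u then binEntropy (t v) else 1 := by simp
  rw [h2, h3, ← Finset.prod_mul_distrib]
  refine Finset.prod_congr rfl fun v _ => ?_
  rw [spin_neg, spin_one, binEntropy]
  split_ifs
  · rw [mul_one, mul_neg_one, ← sub_eq_add_neg]; ring
  · ring

/-- The Gibbs variational principle, tested on the product measure with means `t_v`. -/
theorem le_logPartition {J : Tensor p N} (hJ : ∀ i, ¬ Function.Injective i → J i = 0)
    {t : Fin N → ℝ} (ht : ∀ v, |t v| ≤ 1) (β : ℝ) :
    β * tensorForm J t - ∑ v, binEntropy (t v) ≤ logPartition J β := by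
  set A := β * tensorForm J t - ∑ v, binEntropy (t v) with hA
  set w : Config N → ℝ := fun x => ∏ v, (1 + t v * spin (x v)) with hw
  have hw0 : ∀ x, 0 ≤ w x := by
    intro x
    refine Finset.prod_nonneg fun v _ => ?_
    have := abs_le.1 (ht v)
    rcases spin_eq_or (x v) with h | h <;> rw [h] <;> linarith
  -- This is `1 + u ≤ exp u` at `u = β H - A - log w`, multiplied by `w`. `A` is the value for which
  -- the bracket sums to zero, so summation gives `1 ≤ exp (-A) Z`.
  have hpt : ∀ x, w x + (β * (w x * hamiltonian J x) - A * w x - w x * Real.log (w x))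
      ≤ Real.exp (-A) * Real.exp (β * hamiltonian J x) := by
    intro x
    rw [← Real.exp_add]
    rcases (hw0 x).eq_or_lt with h | h
    · rw [← h]; simp; positivity
    · have h1 := Real.add_one_le_exp (-A + β * hamiltonian J x - Real.log (w x))
      rw [Real.exp_sub, Real.exp_log h, le_div_iff₀ h] at h1
      linarith
  have hsum := Finset.sum_le_sum fun x (_ : x ∈ Finset.univ) => hpt x
  rw [← Finset.mul_sum, ← two_pow_mul_partition, Finset.sum_add_distrib, Finset.sum_sub_distrib,
    Finset.sum_sub_distrib, ← Finset.mul_sum, ← Finset.mul_sum, hw, sum_prod_one_add,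
    sum_prod_one_add_mul_hamiltonian hJ, sum_prod_one_add_mul_log] at hsum
  have h2 : (0 : ℝ) < 2 ^ N := by positivity
  have h3 : (2 : ℝ) ^ N ≤ 2 ^ N * (Real.exp (-A) * partition J β) := by
    rw [hA] at hsum ⊢; linarith
  have h4 : 1 ≤ Real.exp (-A) * partition J β := le_of_mul_le_mul_left (by linarith) h2
  rw [Real.exp_neg, ← div_eq_inv_mul, one_le_div (Real.exp_pos A)] at h4
  exact (Real.le_log_iff_exp_le (partition_pos J β)).2 h4

theorem tensorForm_zero (hp : 2 ≤ p) (J : Tensor p N) : tensorForm J (0 : Fin N → ℝ) = 0 := by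
  unfold tensorForm
  refine Finset.sum_eq_zero fun i _ => ?_
  rw [Finset.prod_eq_zero (Finset.mem_univ (⟨0, by omega⟩ : Fin p)) rfl, mul_zero]

theorem logPartition_nonneg (hp : 2 ≤ p) {J : Tensor p N}
    (hJ : ∀ i, ¬ Function.Injective i → J i = 0) (β : ℝ) : 0 ≤ logPartition J β := by
  have h := le_logPartition hJ (t := 0) (by simp) β
  rw [tensorForm_zero hp] at h
  simpa [binEntropy_zero] using h

theorem one_le_partition (hp : 2 ≤ p) {J : Tensor p N}
    (hJ : ∀ i, ¬ Function.Injective i → J i = 0) (β : ℝ) : 1 ≤ partition J β := by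
  by_contra! h
  have := Real.log_neg (partition_pos J β) h
  have h2 := logPartition_nonneg hp hJ β
  unfold logPartition at h2
  linarith

theorem logPartition_le_partition (J : Tensor p N) (β : ℝ) : logPartition J β ≤ partition J β :=
  Real.log_le_self (partition_pos J β).le

theorem sum_hamiltonian (hp : 2 ≤ p) {J : Tensor p N}
    (hJ : ∀ i, ¬ Function.Injective i → J i = 0) : ∑ x, hamiltonian J x = 0 := by
  have h := sum_prod_one_add_mul_hamiltonian hJ 0
  rw [tensorForm_zero hp] at h
  simpa using h

end Gibbs

/-! ### Below the threshold -/

section Threshold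

variable {p K : ℕ} {lam : Fin K → ℝ} {θ : (Fin p → Fin K) → ℝ}

theorem phi_eq (β : ℝ) (t : Fin K → ℝ) :
    phi lam θ β t = β * energy lam θ t - ∑ j, lam j * binEntropy (t j) := rfl

theorem abs_le_one_of_mem_cube {t : Fin K → ℝ} (ht : t ∈ {t : Fin K → ℝ | ∀ j, t j ∈ Set.Icc (0 : ℝ) 1})
    (j : Fin K) : |t j| ≤ 1 := by
  rw [abs_of_nonneg (ht j).1]; exact (ht j).2

theorem le_one_of_sum_eq_one (h0 : ∀ j, 0 ≤ lam j) (h1 : ∑ j, lam j = 1) (j : Fin K) :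
    lam j ≤ 1 := by
  rw [← h1]; exact Finset.single_le_sum (fun k _ => h0 k) (Finset.mem_univ j)

theorem energy_le (h0 : ∀ j, 0 ≤ lam j) (h1 : ∑ j, lam j = 1)
    (hθ : ∀ j, θ j ∈ Set.Icc (0 : ℝ) 1) {t : Fin K → ℝ} (ht : ∀ j, |t j| ≤ 1) :
    energy lam θ t ≤ (K : ℝ) ^ p := by
  have h : ∀ j : Fin p → Fin K, θ j * ∏ l, (lam (j l) * t (j l)) ≤ 1 := by
    intro j
    refine (le_abs_self _).trans ?_
    rw [abs_mul, abs_of_nonneg (hθ j).1]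
    refine mul_le_one₀ (hθ j).2 (abs_nonneg _) (abs_prod_le_one _ _ fun l _ => ?_)
    rw [abs_mul, abs_of_nonneg (h0 _)]
    exact mul_le_one₀ (le_one_of_sum_eq_one h0 h1 _) (abs_nonneg _) (ht _)
  refine (Finset.sum_le_sum fun j _ => h j).trans ?_
  simp

/-- The threshold is defined through the cube `[0,1]^K`, whereas block means range over `[-1,1]`;
nonnegativity of `θ` and evenness of the entropy bridge the two. -/
theorem energy_le_energy_abs (h0 : ∀ j, 0 ≤ lam j)
    (hθ : ∀ j, θ j ∈ Set.Icc (0 : ℝ) 1) (t : Fin K → ℝ) :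
    energy lam θ t ≤ energy lam θ fun j => |t j| := by
  refine Finset.sum_le_sum fun j _ => mul_le_mul_of_nonneg_left ?_ (hθ j).1
  refine (le_abs_self _).trans ?_
  rw [Finset.abs_prod]
  apply le_of_eq
  refine Finset.prod_congr rfl fun l _ => ?_
  rw [abs_mul, abs_of_nonneg (h0 _)]

theorem bddAbove_phi (h0 : ∀ j, 0 ≤ lam j) (h1 : ∑ j, lam j = 1)
    (hθ : ∀ j, θ j ∈ Set.Icc (0 : ℝ) 1) {β : ℝ} (hβ : 0 ≤ β) :
    BddAbove (phi lam θ β '' {t | ∀ j, t j ∈ Set.Icc (0 : ℝ) 1}) := by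
  refine ⟨β * (K : ℝ) ^ p, ?_⟩
  rintro _ ⟨t, ht, rfl⟩
  have ht' := abs_le_one_of_mem_cube ht
  have h2 := mul_le_mul_of_nonneg_left (energy_le h0 h1 hθ ht') hβ
  have h3 : 0 ≤ ∑ j, lam j * binEntropy (t j) :=
    Finset.sum_nonneg fun j _ => mul_nonneg (h0 j) (binEntropy_nonneg (ht' j))
  rw [phi_eq]; linarith

/-- Below the threshold the energy is dominated by a fraction of the entropy. -/
theorem exists_energy_le_of_lt_betaStar (h0 : ∀ j, 0 ≤ lam j) (h1 : ∑ j, lam j = 1)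
    (hθ : ∀ j, θ j ∈ Set.Icc (0 : ℝ) 1) {β : ℝ} (hβ : 0 ≤ β)
    (hlt : (β : EReal) < betaStar lam θ) :
    ∃ c : ℝ, 0 ≤ c ∧ c < 1 ∧ ∀ t : Fin K → ℝ, (∀ j, |t j| ≤ 1) →
      β * energy lam θ t ≤ c * ∑ j, lam j * binEntropy (t j) := by
  obtain ⟨_, ⟨β', hβ', rfl, hsup⟩, hlt'⟩ := lt_sSup_iff.1 hlt
  rw [EReal.coe_lt_coe_iff] at hlt'
  have hpos : 0 < β' := hβ.trans_lt hlt'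
  -- `β'` is an admissible parameter strictly above `β`; linearity of the functional in the
  -- parameter makes the ratio the required fraction.
  refine ⟨β / β', by positivity, (div_lt_one hpos).2 hlt', fun t ht => ?_⟩
  have hmem : (fun j => |t j|) ∈ {t : Fin K → ℝ | ∀ j, t j ∈ Set.Icc (0 : ℝ) 1} :=
    fun j => ⟨abs_nonneg _, ht j⟩
  have h2 := le_csSup (bddAbove_phi (p := p) h0 h1 hθ hβ') (Set.mem_image_of_mem _ hmem)
  rw [hsup, phi_eq] at h2
  simp only [binEntropy_abs] at h2
  have h3 := energy_le_energy_abs h0 hθ t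
  calc β * energy lam θ t ≤ β * energy lam θ fun j => |t j| := mul_le_mul_of_nonneg_left h3 hβ
    _ = β / β' * (β' * energy lam θ fun j => |t j|) := by field_simp
    _ ≤ _ := mul_le_mul_of_nonneg_left (by linarith) (by positivity)

/-- The first-moment bound behind all the statements below the threshold. For fixed `x` the exponent
is at most `c` times the block entropies plus a constant; replacing `N λ_j` by the true block size
costs at most one per block, as the entropy lies in `[0,1]`. -/
theorem exists_integral_partition_le (hp : 2 ≤ p) (h0 : ∀ j, 0 ≤ lam j) (h1 : ∑ j, lam j = 1)
    (hθ : ∀ j, θ j ∈ Set.Icc (0 : ℝ) 1)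
    (hs : ∀ (σ : Equiv.Perm (Fin p)) (j : Fin p → Fin K), θ (j ∘ σ) = θ j)
    {β : ℝ} (hβ : 0 ≤ β) (hlt : (β : EReal) < betaStar lam θ) :
    ∃ C : ℝ, ∀ N : ℕ, ∫ G, partition (interaction G) β ∂law lam θ N ≤ C := by
  obtain ⟨c, hc0, hc1, hc⟩ := exists_energy_le_of_lt_betaStar h0 h1 hθ hβ hlt
  set E : ℝ := β * ((p : ℝ) ^ 2 + (K : ℝ) ^ p * p) + c * K + expConst p β with hE
  suffices h : ∀ N : ℕ, 0 < N → ∫ G, partition (interaction G) β ∂law lam θ N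
      ≤ Real.exp E * entropyConst c ^ K by
    refine ⟨max (Real.exp E * entropyConst c ^ K)
      (∫ G, partition (interaction G) β ∂law lam θ 0), fun N => ?_⟩
    rcases N.eq_zero_or_pos with rfl | hN
    · exact le_max_right _ _
    · exact (h N hN).trans (le_max_left _ _)
  intro N hN
  obtain ⟨b, hb⟩ := exists_blockIndex lam h0 h1 N
  have := isProbabilityMeasure_law hb hθ
  have hx : ∀ x : Config N, ∫ G, Real.exp (β * hamiltonian (interaction G) x) ∂law lam θ N
      ≤ Real.exp E * Real.exp (c * ∑ j,
        ((Finset.univ.filter fun v => b v = j).card : ℝ) * binEntropy (blockMean b x j)) := by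
    intro x
    have hf : ∀ v, |spin (x v)| ≤ 1 := fun v => (abs_spin _).le
    refine (integral_exp_tensorForm_le hp hN hb hθ hs hf β).trans ?_
    rw [← Real.exp_add, Real.exp_le_exp]
    have ht : ∀ j, |blockMean b x j| ≤ 1 := fun j => abs_meanSpin_le _
    have h2 := abs_le.1 (abs_meanForm_sub_le hp hN h0 h1 hb hθ hf ht (card_mul_blockMean b x))
    have h3 := mul_le_mul_of_nonneg_left h2.2 hβ
    have h4 := mul_le_mul_of_nonneg_left (hc _ ht) (Nat.cast_nonneg (α := ℝ) N)
    have h5 : (N : ℝ) * (c * ∑ j, lam j * binEntropy (blockMean b x j)) ≤ c * (∑ j,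
        ((Finset.univ.filter fun v => b v = j).card : ℝ) * binEntropy (blockMean b x j)) + c * K := by
      rw [mul_left_comm, ← mul_add]
      refine mul_le_mul_of_nonneg_left ?_ hc0
      have : (K : ℝ) = ∑ _j : Fin K, 1 := by simp
      rw [this, Finset.mul_sum, ← Finset.sum_add_distrib]
      refine Finset.sum_le_sum fun j _ => ?_
      have h6 := (abs_le.1 (abs_card_block_sub_le h0 h1 hb j)).1
      have h7 := binEntropy_nonneg (ht j)
      have h8 := binEntropy_le_one (ht j)
      nlinarith
    rw [hE]
    linarith
  unfold partition
  rw [integral_const_mul, integral_finsetSum _ fun x _ => Integrable.of_finite]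
  refine (mul_le_mul_of_nonneg_left (Finset.sum_le_sum fun x _ => hx x) (by positivity)).trans ?_
  rw [← Finset.mul_sum]
  have h9 := mul_le_mul_of_nonneg_left (sum_exp_blockMean_le b hc0 hc1) (Real.exp_pos E).le
  refine (mul_le_mul_of_nonneg_left h9 (by positivity)).trans ?_
  apply le_of_eq
  field_simp

theorem exists_abs_integral_logPartition_le (hp : 2 ≤ p) (h0 : ∀ j, 0 ≤ lam j)
    (h1 : ∑ j, lam j = 1) (hθ : ∀ j, θ j ∈ Set.Icc (0 : ℝ) 1)
    (hs : ∀ (σ : Equiv.Perm (Fin p)) (j : Fin p → Fin K), θ (j ∘ σ) = θ j)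
    {β : ℝ} (hβ : 0 ≤ β) (hlt : (β : EReal) < betaStar lam θ) :
    ∃ C : ℝ, ∀ N : ℕ, |∫ G, logPartition (interaction G) β ∂law lam θ N| ≤ C := by
  obtain ⟨C, hC⟩ := exists_integral_partition_le hp h0 h1 hθ hs hβ hlt
  refine ⟨C, fun N => ?_⟩
  obtain ⟨b, hb⟩ := exists_blockIndex lam h0 h1 N
  have := isProbabilityMeasure_law hb hθ
  rw [abs_of_nonneg (integral_nonneg fun G => logPartition_nonneg hp
    (fun i hi => interaction_eq_zero hi) β)]
  exact (integral_mono Integrable.of_finite Integrable.of_finite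
    fun G => logPartition_le_partition _ _).trans (hC N)

end Threshold

/-! ### The Kullback–Leibler divergence of the joint laws -/

instance isMarkovKernel_isingKernel (p N : ℕ) (β : ℝ) : IsMarkovKernel (isingKernel p N β) :=
  ⟨fun G => isProbabilityMeasure_ising (interaction G) β⟩

section KL

variable {p K N : ℕ} {lam : Fin K → ℝ} {θ : (Fin p → Fin K) → ℝ}

/-- The logarithm of the likelihood ratio of two Ising models with the same interaction. -/
noncomputable def logRatio (β₁ β₂ : ℝ) (z : Hypergraph p N × Config N) : ℝ :=
  (β₁ - β₂) * hamiltonian (interaction z.1) z.2 + logPartition (interaction z.1) β₂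
    - logPartition (interaction z.1) β₁

theorem weight_eq_mul (J : Tensor p N) (β₁ β₂ : ℝ) (x : Config N) :
    weight J β₁ x = Real.exp ((β₁ - β₂) * hamiltonian J x + logPartition J β₂
      - logPartition J β₁) * weight J β₂ x := by
  have h1 := partition_pos J β₁
  have h2 := partition_pos J β₂
  unfold weight logPartition
  rw [Real.exp_sub, Real.exp_add, Real.exp_log h1, Real.exp_log h2, sub_mul, Real.exp_sub]
  field_simp

theorem jointLaw_singleton [IsFiniteMeasure (law lam θ N)] (β : ℝ) (G : Hypergraph p N)
    (x : Config N) : jointLaw lam θ N β {(G, x)}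
      = ENNReal.ofReal (weight (interaction G) β x) * law lam θ N {G} := by
  rw [jointLaw, ← Set.singleton_prod_singleton, Measure.compProd_apply_prod
    (measurableSet_singleton G) (measurableSet_singleton x), lintegral_singleton,
    ← ising_singleton]
  rfl

theorem jointLaw_eq_withDensity [IsFiniteMeasure (law lam θ N)] (β₁ β₂ : ℝ) :
    jointLaw lam θ N β₁
      = (jointLaw lam θ N β₂).withDensity fun z => ENNReal.ofReal (Real.exp (logRatio β₁ β₂ z)) := by
  refine Measure.ext_of_singleton fun z => ?_
  obtain ⟨G, x⟩ := z
  rw [withDensity_apply _ (measurableSet_singleton _), lintegral_singleton, jointLaw_singleton,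
    jointLaw_singleton, weight_eq_mul _ β₁ β₂, ENNReal.ofReal_mul (Real.exp_pos _).le, mul_assoc]
  rfl

/-- The hypergraph has the same law under both measures, so only the ratio of spin laws enters. In
the expected log-ratio, the energy term and the free energy at `β₁` both have a favourable sign and
can be dropped. -/
theorem klDiv_jointLaw_le (hp : 2 ≤ p) [IsProbabilityMeasure (law lam θ N)] {β₁ β₂ : ℝ}
    (hβ₁ : 0 ≤ β₁) (h12 : β₁ ≤ β₂) :
    InformationTheory.klDiv (jointLaw lam θ N β₁) (jointLaw lam θ N β₂)
      ≤ ENNReal.ofReal (∫ G, logPartition (interaction G) β₂ ∂law lam θ N) := by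
  have hP1 : IsProbabilityMeasure (jointLaw lam θ N β₁) := by unfold jointLaw; infer_instance
  have hP2 : IsProbabilityMeasure (jointLaw lam θ N β₂) := by unfold jointLaw; infer_instance
  have hd := jointLaw_eq_withDensity (lam := lam) (θ := θ) (N := N) β₁ β₂
  have hac : jointLaw lam θ N β₁ ≪ jointLaw lam θ N β₂ := by
    rw [hd]; exact withDensity_absolutelyContinuous _ _
  have hmeas : Measurable fun z : Hypergraph p N × Config N =>
      ENNReal.ofReal (Real.exp (logRatio β₁ β₂ z)) := measurable_of_finite _
  have hrn : (jointLaw lam θ N β₁).rnDeriv (jointLaw lam θ N β₂)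
      =ᵐ[jointLaw lam θ N β₁] fun z => ENNReal.ofReal (Real.exp (logRatio β₁ β₂ z)) := by
    refine hac.ae_le ?_
    have h := Measure.rnDeriv_withDensity (jointLaw lam θ N β₂) hmeas
    rwa [← hd] at h
  have hllr : llr (jointLaw lam θ N β₁) (jointLaw lam θ N β₂)
      =ᵐ[jointLaw lam θ N β₁] logRatio β₁ β₂ := by
    filter_upwards [hrn] with z hz
    rw [llr, hz, ENNReal.toReal_ofReal (Real.exp_pos _).le, Real.log_exp]
  rw [InformationTheory.klDiv_of_ac_of_integrable hac Integrable.of_finite, integral_congr_ae hllr]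
  simp only [probReal_univ, add_sub_cancel_right]
  refine ENNReal.ofReal_le_ofReal ?_
  rw [jointLaw, Measure.integral_compProd Integrable.of_finite]
  refine integral_mono Integrable.of_finite Integrable.of_finite fun G => ?_
  have hJ : ∀ i, ¬ Function.Injective i → interaction G i = 0 := fun i hi => interaction_eq_zero hi
  change ∫ x, logRatio β₁ β₂ (G, x) ∂ising (interaction G) β₁ ≤ logPartition (interaction G) β₂
  rw [integral_ising]
  have hF1 := logPartition_nonneg hp hJ β₁
  have hZ := partition_pos (interaction G) β₁
  -- Under uniform spins the Hamiltonian has mean zero, and `h (exp (β₁ h) - 1) ≥ 0` pointwise.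
  have hH : 0 ≤ ∑ x, weight (interaction G) β₁ x * hamiltonian (interaction G) x := by
    unfold weight
    simp_rw [div_mul_eq_mul_div]
    rw [← Finset.sum_div]
    refine div_nonneg ?_ (by positivity)
    rw [← sum_hamiltonian hp hJ]
    refine Finset.sum_le_sum fun x _ => ?_
    rcases le_total 0 (hamiltonian (interaction G) x) with h | h
    · exact le_mul_of_one_le_left h (Real.one_le_exp (mul_nonneg hβ₁ h))
    · have : Real.exp (β₁ * hamiltonian (interaction G) x) ≤ 1 :=
        Real.exp_le_one_iff.2 (mul_nonpos_of_nonneg_of_nonpos hβ₁ h)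
      nlinarith
  have e : ∑ x, weight (interaction G) β₁ x * logRatio β₁ β₂ (G, x)
      = (β₁ - β₂) * ∑ x, weight (interaction G) β₁ x * hamiltonian (interaction G) x
        + (logPartition (interaction G) β₂ - logPartition (interaction G) β₁) := by
    have : logPartition (interaction G) β₂ - logPartition (interaction G) β₁
        = ∑ x, weight (interaction G) β₁ x *
          (logPartition (interaction G) β₂ - logPartition (interaction G) β₁) := by
      rw [← Finset.sum_mul, sum_weight, one_mul]
    rw [this, Finset.mul_sum, ← Finset.sum_add_distrib]
    refine Finset.sum_congr rfl fun x _ => ?_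
    unfold logRatio
    ring
  rw [e]
  have := mul_nonneg (sub_nonneg.2 h12) hH
  linarith

end KL

/-! ### Non-existence of consistent estimators -/

section Nonexistence

variable {p N : ℕ} {J : Tensor p N}

theorem partition_le_one_add (J : Tensor p N) {β q : ℝ} (hβ : 0 ≤ β) (hq : β ≤ q) :
    partition J β ≤ 1 + partition J q := by
  have h2 : (0 : ℝ) < 2 ^ N := by positivity
  refine le_of_mul_le_mul_left ?_ h2
  rw [mul_add, two_pow_mul_partition, two_pow_mul_partition]
  have : (2 : ℝ) ^ N * 1 = ∑ _x : Config N, 1 := by simp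
  rw [this, ← Finset.sum_add_distrib]
  refine Finset.sum_le_sum fun x _ => ?_
  rcases le_total 0 (hamiltonian J x) with h | h
  · have := Real.exp_le_exp.2 (mul_le_mul_of_nonneg_right hq h)
    linarith
  · have := Real.exp_le_one_iff.2 (mul_nonpos_of_nonneg_of_nonpos hβ h)
    linarith [Real.exp_pos (q * hamiltonian J x)]

/-- A quantitative form of the contiguity of two Ising models with bounded partition functions. -/
theorem ising_real_le (hp : 2 ≤ p) (hJ : ∀ i, ¬ Function.Injective i → J i = 0) {β₁ β₂ T : ℝ}
    (h1 : 0 ≤ β₁) (h12 : β₁ < β₂) (hT : 0 < T) (S : Set (Config N)) :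
    (ising J β₁).real S ≤ Real.exp ((β₂ - β₁) * T) * partition J β₂ * (ising J β₂).real S
      + partition J β₂ / (β₂ * T) := by
  classical
  have hβ₂ : 0 < β₂ := h1.trans_lt h12
  have hZ1 := one_le_partition hp hJ β₁
  have hZ2 := partition_pos J β₂
  have h2N : (0 : ℝ) < 2 ^ N := by positivity
  -- Split at `h = -T`. Above, the likelihood ratio is bounded. Below, the `β₁`-weight is at most
  -- `2^{-N}`, and a Markov argument applies to the nonnegative function `exp (β₂ h) / β₂ - h`,
  -- which exceeds `T` there and has uniform mean `Z / β₂`, the Hamiltonian being centred.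
  have hpt : ∀ x, (if x ∈ S then weight J β₁ x else 0)
      ≤ Real.exp ((β₂ - β₁) * T) * partition J β₂ * (if x ∈ S then weight J β₂ x else 0)
        + (Real.exp (β₂ * hamiltonian J x) / β₂ - hamiltonian J x) / (T * 2 ^ N) := by
    intro x
    set h := hamiltonian J x with hh
    have hlin : h ≤ Real.exp (β₂ * h) / β₂ := by
      rw [le_div_iff₀ hβ₂]
      linarith [Real.add_one_le_exp (β₂ * h)]
    have hrest : 0 ≤ (Real.exp (β₂ * h) / β₂ - h) / (T * 2 ^ N) :=
      div_nonneg (by linarith) (by positivity)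
    by_cases hx : x ∈ S
    · rw [if_pos hx, if_pos hx]
      by_cases hhT : -T ≤ h
      · have : weight J β₁ x ≤ Real.exp ((β₂ - β₁) * T) * partition J β₂ * weight J β₂ x := by
          unfold weight
          rw [← hh]
          have e : Real.exp ((β₂ - β₁) * T) * partition J β₂ *
              (Real.exp (β₂ * h) / (2 ^ N * partition J β₂))
              = Real.exp ((β₂ - β₁) * T + β₂ * h) / 2 ^ N := by
            rw [Real.exp_add]; field_simp
          rw [e]
          refine div_le_div₀ (Real.exp_pos _).le (Real.exp_le_exp.2 ?_) h2N
            (le_mul_of_one_le_right h2N.le hZ1)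
          nlinarith
        linarith
      · have hh0 : h ≤ 0 := by linarith
        have h3 : weight J β₁ x ≤ 1 / 2 ^ N := by
          unfold weight
          exact div_le_div₀ zero_le_one
            (Real.exp_le_one_iff.2 (mul_nonpos_of_nonneg_of_nonpos h1 hh0)) h2N
            (le_mul_of_one_le_right h2N.le hZ1)
        have h4 : 1 / 2 ^ N ≤ (Real.exp (β₂ * h) / β₂ - h) / (T * 2 ^ N) := by
          rw [div_le_div_iff₀ h2N (by positivity), one_mul]
          refine mul_le_mul_of_nonneg_right ?_ h2N.le
          have : 0 < Real.exp (β₂ * h) / β₂ := by positivity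
          linarith
        have h5 : 0 ≤ Real.exp ((β₂ - β₁) * T) * partition J β₂ * weight J β₂ x :=
          mul_nonneg (by positivity) (weight_nonneg _ _ _)
        linarith
    · rw [if_neg hx, if_neg hx, mul_zero, zero_add]
      exact hrest
  have hsum := Finset.sum_le_sum fun x (_ : x ∈ Finset.univ) => hpt x
  rw [Finset.sum_add_distrib, ← Finset.mul_sum, ← Finset.sum_filter, ← Finset.sum_filter,
    ← ising_real, ← ising_real, ← Finset.sum_div, Finset.sum_sub_distrib, ← Finset.sum_div,
    ← two_pow_mul_partition, sum_hamiltonian hp hJ, sub_zero] at hsum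
  refine hsum.trans (le_of_eq ?_)
  congr 1
  field_simp

theorem not_consistentAt_of_frequently (hp : 2 ≤ p) {J : ∀ N, Tensor p N}
    (hJ : ∀ N i, ¬ Function.Injective i → J N i = 0) {β₁ β₂ C : ℝ} (h1 : 0 ≤ β₁) (h12 : β₁ < β₂)
    (hC : ∃ᶠ N in atTop, partition (J N) β₂ ≤ C) (est : ∀ N, Config N → EReal)
    (hc1 : ConsistentAt J est β₁) (hc2 : ConsistentAt J est β₂) : False := by
  have hβ₂ : 0 < β₂ := h1.trans_lt h12
  have hε : 0 < (β₂ - β₁) / 3 := by linarith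
  have hC0 : 0 < C := by
    obtain ⟨N, hN⟩ := hC.exists
    exact (partition_pos _ _).trans_le hN
  -- `T` makes the tail term of `ising_real_le` at most `1/4`, and `1 / (4R)` does the same for the
  -- main term. The event near `β₁` then has probability at most `1/2`, against more than `1/2` from
  -- consistency.
  set T := 4 * C / β₂ with hT
  have hTpos : 0 < T := by positivity
  set R := Real.exp ((β₂ - β₁) * T) * C with hR
  have hRpos : 0 < R := by positivity
  have e1 := (hc1 _ hε).eventually (lt_mem_nhds (show (1 / 2 : ℝ) < 1 by norm_num))
  have e2 := (hc2 _ hε).eventually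
    (lt_mem_nhds (show 1 - 1 / (4 * R) < 1 from sub_lt_self _ (by positivity)))
  obtain ⟨N, hN, hA, hB⟩ := (hC.and_eventually (e1.and e2)).exists
  set A := {x : Config N | ∃ b : ℝ, est N x = (b : EReal) ∧ |b - β₁| ≤ (β₂ - β₁) / 3} with hAdef
  set B := {x : Config N | ∃ b : ℝ, est N x = (b : EReal) ∧ |b - β₂| ≤ (β₂ - β₁) / 3} with hBdef
  have hAB : A ⊆ Bᶜ := by
    rintro x ⟨b, hb, hb1⟩ ⟨b', hb', hb2⟩
    rw [hb, EReal.coe_eq_coe_iff] at hb'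
    subst hb'
    rw [abs_le] at hb1 hb2
    linarith [hb1.2, hb2.1]
  have hA2 : (ising (J N) β₂).real A < 1 / (4 * R) := by
    have h3 := measureReal_mono (μ := ising (J N) β₂) hAB
    rw [probReal_compl_eq_one_sub (Set.toFinite B).measurableSet] at h3
    linarith
  have h4 := ising_real_le hp (hJ N) h1 h12 hTpos A
  have h5 : Real.exp ((β₂ - β₁) * T) * partition (J N) β₂ * (ising (J N) β₂).real A ≤ 1 / 4 := by
    have h6 : Real.exp ((β₂ - β₁) * T) * partition (J N) β₂ ≤ R :=
      mul_le_mul_of_nonneg_left hN (Real.exp_pos _).le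
    calc _ ≤ R * (1 / (4 * R)) :=
          mul_le_mul h6 hA2.le measureReal_nonneg hRpos.le
      _ = 1 / 4 := by field_simp
  have h7 : partition (J N) β₂ / (β₂ * T) ≤ 1 / 4 := by
    rw [div_le_iff₀ (by positivity), hT]
    refine hN.trans (le_of_eq ?_)
    field_simp
  linarith

end Nonexistence

/-- Bounded means give, by Fatou, an almost surely finite lower limit, whatever the joint
distribution. Only a random subsequence is controlled, which suffices to refute consistency. -/
theorem ae_frequently_partition_le {p K : ℕ} (hp : 2 ≤ p) {lam : Fin K → ℝ}
    (h0 : ∀ j, 0 ≤ lam j) (h1 : ∑ j, lam j = 1) {θ : (Fin p → Fin K) → ℝ}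
    (hθ : ∀ j, θ j ∈ Set.Icc (0 : ℝ) 1)
    (hs : ∀ (σ : Equiv.Perm (Fin p)) (j : Fin p → Fin K), θ (j ∘ σ) = θ j)
    {Ω : Type*} [MeasurableSpace Ω] (P : Measure Ω) (H : ∀ N : ℕ, Ω → Hypergraph p N)
    (hH : ∀ N, HasLaw (H N) (law lam θ N) P)
    {β : ℝ} (hβ : 0 ≤ β) (hlt : (β : EReal) < betaStar lam θ) :
    ∀ᵐ ω ∂P, ∃ C : ℝ, ∃ᶠ N in atTop, partition (interaction (H N ω)) β ≤ C := by
  obtain ⟨C, hC⟩ := exists_integral_partition_le hp h0 h1 hθ hs hβ hlt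
  set Z : ∀ N, Hypergraph p N → ENNReal := fun N G =>
    ENNReal.ofReal (partition (interaction G) β) with hZ
  have hZm : ∀ N, Measurable (Z N) := fun N => measurable_of_finite _
  have hint : ∀ N, ∫⁻ ω, Z N (H N ω) ∂P ≤ ENNReal.ofReal C := by
    intro N
    obtain ⟨b, hb⟩ := exists_blockIndex lam h0 h1 N
    have := isProbabilityMeasure_law hb hθ
    rw [← lintegral_map' (hZm N).aemeasurable (hH N).aemeasurable, (hH N).map_eq,
      ← ofReal_integral_eq_lintegral_ofReal Integrable.of_finite
        (Eventually.of_forall fun G => (partition_pos _ _).le)]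
    exact ENNReal.ofReal_le_ofReal (hC N)
  have hfatou : ∫⁻ ω, liminf (fun N => Z N (H N ω)) atTop ∂P ≤ ENNReal.ofReal C :=
    (lintegral_liminf_le' fun N => (hZm N).comp_aemeasurable (hH N).aemeasurable).trans
      ((liminf_le_liminf (Eventually.of_forall hint)).trans (by simp))
  -- The `H N` are only almost everywhere measurable, so the lower limit is compared with that of
  -- measurable versions.
  have hm : AEMeasurable (fun ω => liminf (fun N => Z N (H N ω)) atTop) P := by
    refine ⟨fun ω => liminf (fun N => Z N ((hH N).aemeasurable.mk _ ω)) atTop,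
      Measurable.liminf fun N => (hZm N).comp (hH N).aemeasurable.measurable_mk, ?_⟩
    filter_upwards [ae_all_iff.2 fun N => (hH N).aemeasurable.ae_eq_mk] with ω hω
    simp_rw [← hω]
  filter_upwards [ae_lt_top' hm (hfatou.trans_lt ENNReal.ofReal_lt_top).ne] with ω hω
  obtain ⟨r, hr, hr'⟩ := exists_between hω
  refine ⟨r.toReal, (frequently_lt_of_liminf_lt (by isBoundedDefault) hr).mono fun N hN => ?_⟩
  exact (ENNReal.ofReal_le_iff_le_toReal hr'.ne).1 hN.le

theorem ae_not_consistentAt {p K : ℕ} (hp : 2 ≤ p) {lam : Fin K → ℝ}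
    (h0 : ∀ j, 0 ≤ lam j) (h1 : ∑ j, lam j = 1) {θ : (Fin p → Fin K) → ℝ}
    (hθ : ∀ j, θ j ∈ Set.Icc (0 : ℝ) 1)
    (hs : ∀ (σ : Equiv.Perm (Fin p)) (j : Fin p → Fin K), θ (j ∘ σ) = θ j)
    {Ω : Type*} [MeasurableSpace Ω] (P : Measure Ω) (H : ∀ N : ℕ, Ω → Hypergraph p N)
    (hH : ∀ N, HasLaw (H N) (law lam θ N) P) :
    ∀ᵐ ω ∂P, ∀ β₁ β₂ : ℝ, 0 ≤ β₁ → β₁ < β₂ → (β₂ : EReal) < betaStar lam θ →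
      ¬ ∃ est : ∀ N : ℕ, Config N → EReal,
        ConsistentAt (fun N => interaction (H N ω)) est β₁ ∧
        ConsistentAt (fun N => interaction (H N ω)) est β₂ := by
  -- A single null set must serve uncountably many pairs. Rational parameters suffice, since a bound
  -- at `q > β₂` passes down to `β₂` by `partition_le_one_add`.
  have hall : ∀ᵐ ω ∂P, ∀ q : ℚ, 0 ≤ (q : ℝ) → ((q : ℝ) : EReal) < betaStar lam θ →
      ∃ C : ℝ, ∃ᶠ N in atTop, partition (interaction (H N ω)) q ≤ C := by
    rw [ae_all_iff]
    intro q
    by_cases hq : 0 ≤ (q : ℝ) ∧ ((q : ℝ) : EReal) < betaStar lam θ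
    · filter_upwards [ae_frequently_partition_le hp h0 h1 hθ hs P H hH hq.1 hq.2] with ω hω _ _
      exact hω
    · exact Eventually.of_forall fun ω ha hb => absurd ⟨ha, hb⟩ hq
  filter_upwards [hall] with ω hω β₁ β₂ hβ₁ h12 hlt
  rintro ⟨est, hc1, hc2⟩
  obtain ⟨q, hq1, hq2⟩ := EReal.lt_iff_exists_rat_btwn.1 hlt
  have hq1' : β₂ < (q : ℝ) := by exact_mod_cast hq1
  obtain ⟨C, hC⟩ := hω q (by linarith) hq2
  refine not_consistentAt_of_frequently hp (fun N i hi => interaction_eq_zero hi) hβ₁ h12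
    (C := 1 + C) (hC.mono fun N hN => ?_) est hc1 hc2
  exact (partition_le_one_add _ (by linarith) hq1'.le).trans (by linarith)

/-! ### Above the threshold: the free energy is extensive -/

section Supercritical

variable {p K : ℕ} {lam : Fin K → ℝ} {θ : (Fin p → Fin K) → ℝ}

theorem phi_zero (hp : 2 ≤ p) (β : ℝ) : phi lam θ β 0 = 0 := by
  rw [phi_eq]
  have : energy lam θ 0 = 0 := by
    refine Finset.sum_eq_zero fun j _ => ?_
    rw [Finset.prod_eq_zero (Finset.mem_univ (⟨0, by omega⟩ : Fin p)) (by simp), mul_zero]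
  simp [this, binEntropy_zero]

theorem betaStar_nonneg (hp : 2 ≤ p) (h0 : ∀ j, 0 ≤ lam j) : 0 ≤ betaStar lam θ := by
  refine le_sSup ⟨0, le_rfl, rfl, le_antisymm ?_ ?_⟩
  · refine Real.sSup_nonpos ?_
    rintro _ ⟨t, ht, rfl⟩
    rw [phi_eq, zero_mul, zero_sub, neg_nonpos]
    exact Finset.sum_nonneg fun j _ =>
      mul_nonneg (h0 j) (binEntropy_nonneg (abs_le_one_of_mem_cube ht j))
  · refine Real.sSup_nonneg' ⟨phi lam θ 0 0, ⟨0, by simp, rfl⟩, (phi_zero hp 0).ge⟩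

theorem pos_of_betaStar_lt (hp : 2 ≤ p) (h0 : ∀ j, 0 ≤ lam j) {β : ℝ}
    (hlt : betaStar lam θ < (β : EReal)) : 0 < β := by
  have := (betaStar_nonneg hp h0).trans_lt hlt
  exact_mod_cast this

theorem exists_phi_pos (hp : 2 ≤ p) (h0 : ∀ j, 0 ≤ lam j) (h1 : ∑ j, lam j = 1)
    (hθ : ∀ j, θ j ∈ Set.Icc (0 : ℝ) 1) {β : ℝ} (hlt : betaStar lam θ < (β : EReal)) :
    ∃ t : Fin K → ℝ, (∀ j, |t j| ≤ 1) ∧ 0 < phi lam θ β t := by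
  have hβ := pos_of_betaStar_lt hp h0 hlt
  by_contra! hcon
  -- If the functional were never positive, its supremum would be the value zero at the origin and
  -- `β` would be admissible.
  refine hlt.not_ge (le_sSup ⟨β, hβ.le, rfl, le_antisymm ?_ ?_⟩)
  · refine Real.sSup_nonpos ?_
    rintro _ ⟨t, ht, rfl⟩
    exact hcon t (abs_le_one_of_mem_cube ht)
  · exact (phi_zero hp β).ge.trans (le_csSup (bddAbove_phi h0 h1 hθ hβ.le) ⟨0, by simp, rfl⟩)

theorem expConst_nonneg (p : ℕ) (s : ℝ) : 0 ≤ expConst p s := by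
  unfold expConst; positivity

theorem law_logPartition_lt_le (hp : 2 ≤ p) (h0 : ∀ j, 0 ≤ lam j) (h1 : ∑ j, lam j = 1)
    (hθ : ∀ j, θ j ∈ Set.Icc (0 : ℝ) 1)
    (hs : ∀ (σ : Equiv.Perm (Fin p)) (j : Fin p → Fin K), θ (j ∘ σ) = θ j)
    {β : ℝ} (hβ : 0 ≤ β) {t : Fin K → ℝ} (ht : ∀ j, |t j| ≤ 1) (r : ℝ) (N : ℕ) :
    (law lam θ N).real {G | logPartition (interaction G) β
        < N * (phi lam θ β t - r) - (β * ((p : ℝ) ^ 2 + (K : ℝ) ^ p * p) + K)}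
      ≤ Real.exp (expConst p (-β) - N * r) := by
  obtain ⟨b, hb⟩ := exists_blockIndex lam h0 h1 N
  have := isProbabilityMeasure_law hb hθ
  rcases N.eq_zero_or_pos with rfl | hN
  · refine measureReal_le_one.trans ?_
    simp [Real.one_le_exp_iff, expConst_nonneg]
  set f : Fin N → ℝ := fun v => t (b v) with hf
  have hf1 : ∀ v, |f v| ≤ 1 := fun v => ht _
  have hft : ∀ j, ∑ v with b v = j, f v
      = ((Finset.univ.filter fun v => b v = j).card : ℝ) * t j := by
    intro j
    rw [← nsmul_eq_mul, ← Finset.sum_const]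
    refine Finset.sum_congr rfl fun v hv => ?_
    rw [hf]; simp only [(Finset.mem_filter.1 hv).2]
  have hmean := (abs_le.1 (abs_meanForm_sub_le hp hN h0 h1 hb hθ hf1 ht hft)).1
  have hmean' := mul_le_mul_of_nonneg_left hmean hβ
  have hent : ∑ v, binEntropy (f v) ≤ N * ∑ j, lam j * binEntropy (t j) + K := by
    have e : ∑ v, binEntropy (f v)
        = ∑ j, ((Finset.univ.filter fun v => b v = j).card : ℝ) * binEntropy (t j) := by
      rw [← Finset.sum_fiberwise Finset.univ b]
      refine Finset.sum_congr rfl fun j _ => ?_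
      rw [← nsmul_eq_mul, ← Finset.sum_const]
      refine Finset.sum_congr rfl fun v hv => ?_
      rw [hf]; simp only [(Finset.mem_filter.1 hv).2]
    have : (K : ℝ) = ∑ _j : Fin K, 1 := by simp
    rw [e, this, Finset.mul_sum, ← Finset.sum_add_distrib]
    refine Finset.sum_le_sum fun j _ => ?_
    have h6 := (abs_le.1 (abs_card_block_sub_le h0 h1 hb j)).2
    have h7 := binEntropy_nonneg (ht j)
    have h8 := binEntropy_le_one (ht j)
    nlinarith
  set Y : Hypergraph p N → ℝ := fun G => Real.exp (-β * tensorForm (interaction G) f) with hY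
  -- By the variational bound, a small free energy forces `β` times the form at `f` to fall short of
  -- its mean by `N r`; exponential Markov at `-β` makes this unlikely.
  have hsub : {G : Hypergraph p N | logPartition (interaction G) β
        < N * (phi lam θ β t - r) - (β * ((p : ℝ) ^ 2 + (K : ℝ) ^ p * p) + K)}
      ⊆ {G | Real.exp (-β * meanForm θ b f + N * r) ≤ Y G} := by
    intro G hG
    simp only [Set.mem_ofPred_eq] at hG ⊢
    rw [hY, Real.exp_le_exp]
    have hG2 := le_logPartition (J := interaction G) (fun i hi => interaction_eq_zero hi) hf1 β
    rw [phi_eq] at hG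
    linarith
  refine (measureReal_mono hsub).trans ?_
  have hmarkov := mul_meas_ge_le_integral_of_nonneg (μ := law lam θ N) (f := Y)
    (Eventually.of_forall fun G => (Real.exp_pos _).le) Integrable.of_finite
    (Real.exp (-β * meanForm θ b f + N * r))
  have hexp := hmarkov.trans (integral_exp_tensorForm_le hp hN hb hθ hs hf1 (-β))
  rw [← le_div_iff₀' (Real.exp_pos _), ← Real.exp_sub] at hexp
  refine hexp.trans (Real.exp_le_exp.2 ?_)
  linarith

theorem exists_ae_eventually_le_logPartition (hp : 2 ≤ p) (h0 : ∀ j, 0 ≤ lam j)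
    (h1 : ∑ j, lam j = 1) (hθ : ∀ j, θ j ∈ Set.Icc (0 : ℝ) 1)
    (hs : ∀ (σ : Equiv.Perm (Fin p)) (j : Fin p → Fin K), θ (j ∘ σ) = θ j)
    {Ω : Type*} [MeasurableSpace Ω] (P : Measure Ω) (H : ∀ N : ℕ, Ω → Hypergraph p N)
    (hH : ∀ N, HasLaw (H N) (law lam θ N) P)
    {β : ℝ} (hlt : betaStar lam θ < (β : EReal)) :
    ∃ ε : ℝ, 0 < ε ∧ ∀ᵐ ω ∂P, ∀ᶠ N : ℕ in atTop,
      ε * N ≤ logPartition (interaction (H N ω)) β := by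
  obtain ⟨t, ht, hpos⟩ := exists_phi_pos hp h0 h1 hθ hlt
  have hβ := pos_of_betaStar_lt hp h0 hlt
  set η := phi lam θ β t with hη
  set C := β * ((p : ℝ) ^ 2 + (K : ℝ) ^ p * p) + K with hC
  -- Half of `η` is spent on the deviation probability, which must be summable for Borel–Cantelli,
  -- and a quarter on absorbing the constant `C` for large `N`.
  refine ⟨η / 4, by linarith, ?_⟩
  set S : ∀ N, Set (Hypergraph p N) := fun N =>
    {G | logPartition (interaction G) β < N * (η - η / 2) - C} with hS
  have hprob : ∀ N, P (H N ⁻¹' S N)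
      ≤ ENNReal.ofReal (Real.exp (expConst p (-β)) * Real.exp (-(η / 2)) ^ N) := by
    intro N
    obtain ⟨b, hb⟩ := exists_blockIndex lam h0 h1 N
    have := isProbabilityMeasure_law hb hθ
    rw [← Measure.map_apply_of_aemeasurable (hH N).aemeasurable (Set.toFinite _).measurableSet,
      (hH N).map_eq, ← ofReal_measureReal]
    refine ENNReal.ofReal_le_ofReal
      ((law_logPartition_lt_le hp h0 h1 hθ hs hβ.le ht (η / 2) N).trans (le_of_eq ?_))
    rw [← Real.exp_nat_mul, ← Real.exp_add]
    congr 1; ring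
  have hsumm : Summable fun N : ℕ =>
      Real.exp (expConst p (-β)) * Real.exp (-(η / 2)) ^ N := by
    refine (summable_geometric_of_lt_one (Real.exp_pos _).le ?_).mul_left _
    exact (Real.exp_lt_exp.2 (by linarith : -(η / 2) < 0)).trans_eq Real.exp_zero
  have htsum : ∑' N, P (H N ⁻¹' S N) ≠ ⊤ :=
    ((ENNReal.tsum_le_tsum hprob).trans_lt hsumm.tsum_ofReal_lt_top).ne
  filter_upwards [ae_eventually_notMem htsum] with ω hω
  filter_upwards [hω, eventually_ge_atTop ⌈C / (η / 4)⌉₊] with N hN hN2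
  have h3 : C ≤ N * (η / 4) := by
    rw [← div_le_iff₀ (by linarith)]
    exact (Nat.le_ceil _).trans (by exact_mod_cast hN2)
  simp only [hS, Set.mem_preimage, Set.mem_ofPred_eq, not_lt] at hN
  linarith

end Supercritical

/-! ### Local fields -/

section LocalField

variable {p N : ℕ}

theorem interaction_comp_perm (G : Hypergraph p N) (σ : Equiv.Perm (Fin p)) (i : Fin p → Fin N) :
    interaction G (i ∘ σ) = interaction G i := by
  have h : Finset.univ.image (i ∘ σ) = Finset.univ.image i := by
    ext v
    simp only [Finset.mem_image, Finset.mem_univ, true_and, Function.comp]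
    exact (σ.surjective.exists (p := fun l => i l = v)).symm
  unfold interaction adjTensor
  simp only [h]

theorem abs_interaction_le (G : Hypergraph p N) (i : Fin p → Fin N) :
    |interaction G i| ≤ 1 / (N : ℝ) ^ (p - 1) := by
  unfold interaction
  rw [abs_div, abs_of_nonneg (by positivity : (0 : ℝ) ≤ (N : ℝ) ^ (p - 1))]
  gcongr
  unfold adjTensor
  split_ifs <;> simp

theorem localField_eq (hp : 2 ≤ p) (J : Tensor p N) (x : Config N) (v : Fin N) :
    localField J x v = ∑ i : Fin p → Fin N, if i ⟨0, by omega⟩ = v then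
      J i * ∏ l ∈ Finset.univ.erase (⟨0, by omega⟩ : Fin p), spin (x (i l)) else 0 := by
  unfold localField
  rw [Finset.sum_filter]
  have he : (Finset.univ.filter fun l : Fin p => l.val ≠ 0)
      = Finset.univ.erase (⟨0, by omega⟩ : Fin p) := by
    ext l; simp [Fin.ext_iff]
  refine Finset.sum_congr rfl fun i _ => ?_
  rw [he]
  have hc : (∀ l : Fin p, l.val = 0 → i l = v) ↔ i ⟨0, by omega⟩ = v := by
    constructor
    · intro h; exact h _ rfl
    · rintro h ⟨l, hl⟩ h0
      simp only at h0; subst h0; exact h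
  simp only [hc]

theorem hamiltonian_eq_sum_localField (hp : 2 ≤ p) (J : Tensor p N) (x : Config N) :
    hamiltonian J x = ∑ v, spin (x v) * localField J x v := by
  simp_rw [localField_eq hp, Finset.mul_sum]
  rw [Finset.sum_comm]
  refine Finset.sum_congr rfl fun i _ => ?_
  simp only [mul_ite, mul_zero]
  rw [Finset.sum_ite_eq, if_pos (Finset.mem_univ _),
    ← Finset.mul_prod_erase _ _ (Finset.mem_univ (⟨0, by omega⟩ : Fin p))]
  ring

theorem abs_localField_le (hp : 2 ≤ p) (hN : 0 < N) (G : Hypergraph p N) (x : Config N)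
    (v : Fin N) : |localField (interaction G) x v| ≤ 1 := by
  have hN' : (0 : ℝ) < N := by exact_mod_cast hN
  rw [localField_eq hp]
  have h : ∀ i : Fin p → Fin N, |if i ⟨0, by omega⟩ = v then interaction G i *
      ∏ l ∈ Finset.univ.erase (⟨0, by omega⟩ : Fin p), spin (x (i l)) else 0|
      ≤ (if i ⟨0, by omega⟩ = v then (1 : ℝ) else 0) * (1 / (N : ℝ) ^ (p - 1)) := by
    intro i
    split_ifs
    · rw [abs_mul, one_mul]
      exact (mul_le_of_le_one_right (abs_nonneg _)
        (abs_prod_le_one _ _ fun l _ => (abs_spin _).le)).trans (abs_interaction_le G i)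
    · simp
  refine (Finset.abs_sum_le_sum_abs _ _).trans ((Finset.sum_le_sum fun i _ => h i).trans ?_)
  rw [← Finset.sum_mul, sum_ite_apply_eq, mul_one_div, div_self (by positivity)]

/-- The configuration `x` with the spin at `v` reversed. -/
def flipAt (v : Fin N) (x : Config N) : Config N := Function.update x v (-x v)

theorem flipAt_same (v : Fin N) (x : Config N) : flipAt v x v = -x v := by simp [flipAt]

theorem flipAt_of_ne {v w : Fin N} (h : w ≠ v) (x : Config N) : flipAt v x w = x w := by
  simp [flipAt, h]

theorem flipAt_flipAt (v : Fin N) (x : Config N) : flipAt v (flipAt v x) = x := by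
  simp [flipAt]

theorem sum_flipAt (v : Fin N) (F : Config N → ℝ) : ∑ x, F (flipAt v x) = ∑ x, F x :=
  Fintype.sum_equiv (Function.Involutive.toPerm _ (flipAt_flipAt v)) _ _ fun _ => rfl

theorem localField_flipAt_same (hp : 2 ≤ p) (G : Hypergraph p N) (x : Config N) (v : Fin N) :
    localField (interaction G) (flipAt v x) v = localField (interaction G) x v := by
  rw [localField_eq hp, localField_eq hp]
  refine Finset.sum_congr rfl fun i _ => ?_
  split_ifs with h
  · by_cases hi : Function.Injective i
    · congr 1
      refine Finset.prod_congr rfl fun l hl => ?_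
      rw [flipAt_of_ne]
      rw [← h]
      exact fun hc => (Finset.mem_erase.1 hl).1 (hi hc)
    · rw [interaction_eq_zero hi, zero_mul, zero_mul]
  · rfl

/-- Only tuples with `v` in one of the slots after the first change: `N^{p-2}` for each slot, each
contributing at most `2 / N^{p-1}`. -/
theorem abs_localField_flipAt_sub_le (hp : 2 ≤ p) (hN : 0 < N) (G : Hypergraph p N) (x : Config N)
    (v w : Fin N) : |localField (interaction G) x w - localField (interaction G) (flipAt v x) w|
      ≤ 2 * p / N := by
  have hN' : (0 : ℝ) < N := by exact_mod_cast hN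
  set l₀ : Fin p := ⟨0, by omega⟩ with hl₀
  rw [localField_eq hp, localField_eq hp, ← Finset.sum_sub_distrib]
  have h : ∀ i : Fin p → Fin N,
      |(if i l₀ = w then interaction G i * ∏ l ∈ Finset.univ.erase l₀, spin (x (i l)) else 0)
        - (if i l₀ = w then interaction G i *
          ∏ l ∈ Finset.univ.erase l₀, spin (flipAt v x (i l)) else 0)|
      ≤ ∑ l ∈ Finset.univ.erase l₀,
        (if i l₀ = w ∧ i l = v then (1 : ℝ) else 0) * (2 / (N : ℝ) ^ (p - 1)) := by
    intro i
    by_cases hi : i l₀ = w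
    · simp only [hi, if_true, true_and]
      rw [← mul_sub, abs_mul]
      refine (mul_le_mul (abs_interaction_le G i) (abs_prod_sub_prod_le _ _ _
        (fun l _ => (abs_spin _).le) fun l _ => (abs_spin _).le) (abs_nonneg _)
        (by positivity)).trans ?_
      rw [Finset.mul_sum]
      refine Finset.sum_le_sum fun l _ => ?_
      by_cases hl : i l = v
      · have h2 : |spin (x (i l)) - spin (flipAt v x (i l))| ≤ 2 := by
          refine (abs_sub _ _).trans ?_
          rw [abs_spin, abs_spin]; norm_num
        rw [if_pos hl, one_mul, div_eq_mul_one_div 2, mul_comm]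
        exact mul_le_mul_of_nonneg_right h2 (by positivity)
      · rw [flipAt_of_ne hl]; simp [hl]
    · simp [hi]
  refine (Finset.abs_sum_le_sum_abs _ _).trans ((Finset.sum_le_sum fun i _ => h i).trans ?_)
  rw [Finset.sum_comm]
  have h3 : ∀ l ∈ Finset.univ.erase l₀, ∑ i : Fin p → Fin N,
      (if i l₀ = w ∧ i l = v then (1 : ℝ) else 0) * (2 / (N : ℝ) ^ (p - 1)) = 2 / N := by
    intro l hl
    rw [← Finset.sum_mul, sum_ite_apply_eq_and (Finset.mem_erase.1 hl).1.symm]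
    have : (N : ℝ) ^ (p - 1) = N * (N : ℝ) ^ (p - 2) := by
      rw [← pow_succ', show p - 2 + 1 = p - 1 by omega]
    rw [this]
    field_simp
  rw [Finset.sum_congr rfl h3, Finset.sum_const, nsmul_eq_mul]
  rw [mul_div_right_comm, mul_comm]
  gcongr
  exact_mod_cast (Finset.card_le_univ _).trans (by simp)

/-- Flipping `v` negates exactly the terms whose tuple contains `v`. An injective tuple contains it
in one slot, and by symmetry of the tensor all `p` slots contribute the same. -/
theorem hamiltonian_sub_flipAt (hp : 2 ≤ p) (G : Hypergraph p N) (x : Config N) (v : Fin N) :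
    hamiltonian (interaction G) x - hamiltonian (interaction G) (flipAt v x)
      = 2 * p * (spin (x v) * localField (interaction G) x v) := by
  set l₀ : Fin p := ⟨0, by omega⟩ with hl₀
  set J := interaction G with hJ
  have hterm : ∀ i : Fin p → Fin N,
      J i * ∏ l, spin (x (i l)) - J i * ∏ l, spin (flipAt v x (i l))
      = ∑ k, if i k = v then 2 * (J i * ∏ l, spin (x (i l))) else 0 := by
    intro i
    by_cases hi : Function.Injective i
    · by_cases hv : ∃ k, i k = v
      · obtain ⟨k, hk⟩ := hv
        rw [Finset.sum_eq_single k, if_pos hk]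
        · have h1 : ∏ l, spin (flipAt v x (i l)) = -∏ l, spin (x (i l)) := by
            rw [← Finset.mul_prod_erase _ _ (Finset.mem_univ k),
              ← Finset.mul_prod_erase _ (fun l => spin (x (i l))) (Finset.mem_univ k), hk,
              flipAt_same, spin_neg, neg_mul]
            congr 2
            refine Finset.prod_congr rfl fun l hl => ?_
            rw [flipAt_of_ne]
            rw [← hk]
            exact fun hc => (Finset.mem_erase.1 hl).1 (hi hc)
          rw [h1]; ring
        · intro l _ hl
          exact if_neg fun hc => hl (hi (hc.trans hk.symm))
        · simp
      · push Not at hv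
        rw [Finset.sum_eq_zero fun k _ => if_neg (hv k)]
        simp_rw [flipAt_of_ne (hv _)]
        exact sub_self _
    · rw [hJ, interaction_eq_zero hi]; simp
  have hslot : ∀ k : Fin p, ∑ i : Fin p → Fin N,
      (if i k = v then 2 * (J i * ∏ l, spin (x (i l))) else 0)
      = 2 * (spin (x v) * localField J x v) := by
    intro k
    have hswap : ∑ i : Fin p → Fin N, (if i k = v then 2 * (J i * ∏ l, spin (x (i l))) else 0)
        = ∑ i : Fin p → Fin N, if i l₀ = v then 2 * (J i * ∏ l, spin (x (i l))) else 0 := by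
      refine Fintype.sum_equiv (Equiv.arrowCongr (Equiv.swap k l₀) (Equiv.refl _)) _ _ fun i => ?_
      have e : (Equiv.arrowCongr (Equiv.swap k l₀) (Equiv.refl (Fin N))) i
          = i ∘ Equiv.swap k l₀ := by
        funext l; simp [Equiv.arrowCongr, Equiv.symm_swap]
      rw [e, hJ, interaction_comp_perm, Function.comp_apply, Equiv.swap_apply_right]
      simp only [Function.comp_apply]
      rw [Equiv.prod_comp (Equiv.swap k l₀) fun l => spin (x (i l))]
    rw [hswap, localField_eq hp, Finset.mul_sum, Finset.mul_sum]
    refine Finset.sum_congr rfl fun i _ => ?_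
    split_ifs with h
    · rw [← Finset.mul_prod_erase _ _ (Finset.mem_univ l₀), h]; ring
    · simp
  unfold hamiltonian
  rw [← Finset.sum_sub_distrib]
  simp_rw [hterm]
  rw [Finset.sum_comm]
  simp_rw [hslot]
  simp; ring

end LocalField

/-! ### The pseudo-likelihood score -/

section Score

variable {p N : ℕ}

/-- The contribution of the vertex `v` to the score of the pseudo-likelihood. -/
noncomputable def scoreAt (J : Tensor p N) (β : ℝ) (x : Config N) (v : Fin N) : ℝ :=
  localField J x v * (spin (x v) - Real.tanh (p * β * localField J x v))

/-- The score of the pseudo-likelihood. -/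
noncomputable def score (J : Tensor p N) (β : ℝ) (x : Config N) : ℝ :=
  hamiltonian J x - ∑ v, localField J x v * Real.tanh (p * β * localField J x v)

theorem score_eq_sum (hp : 2 ≤ p) (J : Tensor p N) (β : ℝ) (x : Config N) :
    score J β x = ∑ v, scoreAt J β x v := by
  rw [score, hamiltonian_eq_sum_localField hp, ← Finset.sum_sub_distrib]
  exact Finset.sum_congr rfl fun v _ => by unfold scoreAt; ring

theorem exp_two_mul_mul_one_sub_tanh (a : ℝ) :
    Real.exp (2 * a) * (1 - Real.tanh a) = 1 + Real.tanh a := by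
  rw [Real.tanh_eq, two_mul, Real.exp_add, Real.exp_neg]
  have := Real.exp_pos a
  field_simp
  ring

/-- The spin at `v` minus its conditional mean is orthogonal to all functions of the
other spins. -/
theorem sum_weight_mul_eq_zero (hp : 2 ≤ p) (G : Hypergraph p N) (β : ℝ) (v : Fin N)
    {g : Config N → ℝ} (hg : ∀ x, g (flipAt v x) = g x) :
    ∑ x, weight (interaction G) β x *
      ((spin (x v) - Real.tanh (p * β * localField (interaction G) x v)) * g x) = 0 := by
  set J := interaction G with hJ
  set F : Config N → ℝ := fun x => weight J β x *
      ((spin (x v) - Real.tanh (p * β * localField J x v)) * g x) with hF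
  have hpair : ∀ x, F x + F (flipAt v x) = 0 := by
    intro x
    have hH := hamiltonian_sub_flipAt hp G x v
    rw [← hJ] at hH
    have hH' : hamiltonian J (flipAt v x)
        = hamiltonian J x - 2 * p * (spin (x v) * localField J x v) := by linarith
    simp only [hF, hg, hJ, localField_flipAt_same hp, flipAt_same, spin_neg]
    rw [← hJ]
    unfold weight
    rw [hH']
    set m := localField J x v
    have h1 := exp_two_mul_mul_one_sub_tanh (p * β * m)
    have h2 := exp_two_mul_mul_one_sub_tanh (-(p * β * m))
    rw [Real.tanh_neg] at h2
    set τ := Real.tanh (p * β * m)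
    -- Flipping multiplies the Gibbs weight by `exp (-2 s a)`, where `s` is the spin and `a = pβm`;
    -- `tanh a` is the conditional mean for which the pair of contributions cancels.
    have key : spin (x v) - τ
        + Real.exp (-(2 * p * (spin (x v) * m) * β)) * (-spin (x v) - τ) = 0 := by
      rcases spin_eq_or (x v) with h | h <;> rw [h]
      · have e : -(2 * (p : ℝ) * (1 * m) * β) = 2 * -(p * β * m) := by ring
        rw [e]; linarith
      · have e : -(2 * (p : ℝ) * (-1 * m) * β) = 2 * (p * β * m) := by ring
        rw [e]; linarith
    have e : Real.exp (β * (hamiltonian J x - 2 * p * (spin (x v) * m)))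
        = Real.exp (β * hamiltonian J x) * Real.exp (-(2 * p * (spin (x v) * m) * β)) := by
      rw [← Real.exp_add]; congr 1; ring
    rw [e]
    have e2 : ∀ E E' D s a : ℝ, E / D * ((s - τ) * a) + E * E' / D * ((-s - τ) * a)
        = E / D * a * (s - τ + E' * (-s - τ)) := by intros; ring
    rw [e2, key, mul_zero]
  have h2 : ∑ x, F x + ∑ x, F (flipAt v x) = 0 := by
    rw [← Finset.sum_add_distrib]; exact Finset.sum_eq_zero fun x _ => hpair x
  rw [sum_flipAt] at h2
  linarith

theorem abs_spin_sub_tanh_le (s : ℤˣ) (a : ℝ) : |spin s - Real.tanh a| ≤ 2 := by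
  refine (abs_sub _ _).trans ?_
  rw [abs_spin]
  linarith [Real.abs_tanh_lt_one a]

theorem abs_scoreAt_le (hp : 2 ≤ p) (hN : 0 < N) (G : Hypergraph p N) (β : ℝ) (x : Config N)
    (v : Fin N) : |scoreAt (interaction G) β x v| ≤ 2 := by
  rw [scoreAt, abs_mul]
  have h1 := abs_localField_le hp hN G x v
  exact (mul_le_of_le_one_left (abs_nonneg _) h1).trans (abs_spin_sub_tanh_le _ _)

theorem abs_scoreAt_sub_le (hp : 2 ≤ p) (hN : 0 < N) (G : Hypergraph p N) {β : ℝ} (hβ : 0 ≤ β)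
    (x : Config N) {v w : Fin N} (hvw : w ≠ v) :
    |scoreAt (interaction G) β x w - scoreAt (interaction G) β (flipAt v x) w|
      ≤ (2 + p * β) * (2 * p / N) := by
  have h1 := abs_localField_flipAt_sub_le hp hN G x v w
  have h2 := abs_localField_le hp hN G (flipAt v x) w
  unfold scoreAt
  rw [flipAt_of_ne hvw]
  set m := localField (interaction G) x w
  set m' := localField (interaction G) (flipAt v x) w
  set s := spin (x w)
  have e : m * (s - Real.tanh (p * β * m)) - m' * (s - Real.tanh (p * β * m'))
      = (m - m') * (s - Real.tanh (p * β * m))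
        + m' * (Real.tanh (p * β * m') - Real.tanh (p * β * m)) := by ring
  rw [e]
  have h3 : |(m - m') * (s - Real.tanh (p * β * m))| ≤ |m - m'| * 2 := by
    rw [abs_mul]
    exact mul_le_mul_of_nonneg_left (abs_spin_sub_tanh_le _ _) (abs_nonneg _)
  have h4 : |m' * (Real.tanh (p * β * m') - Real.tanh (p * β * m))| ≤ p * β * |m - m'| := by
    rw [abs_mul]
    refine (mul_le_of_le_one_left (abs_nonneg _) h2).trans ((abs_tanh_sub_le _ _).trans ?_)
    rw [← mul_sub, abs_mul, abs_sub_comm, abs_of_nonneg (by positivity : 0 ≤ p * β)]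
  have h5 : 0 ≤ 2 + p * β := by positivity
  calc _ ≤ |m - m'| * 2 + p * β * |m - m'| := (abs_add_le _ _).trans (add_le_add h3 h4)
    _ = (2 + p * β) * |m - m'| := by ring
    _ ≤ _ := mul_le_mul_of_nonneg_left h1 h5

/-- Replace the score at `w` by its average over flipping `v`. That average does not depend on the
spin at `v`, so its product with the score at `v` has mean zero; the remainder is the influence of
one spin on another vertex, of order `1/N`. -/
theorem sum_weight_scoreAt_mul_le (hp : 2 ≤ p) (hN : 0 < N) (G : Hypergraph p N) {β : ℝ}
    (hβ : 0 ≤ β) {v w : Fin N} (hvw : w ≠ v) :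
    ∑ x, weight (interaction G) β x *
      (scoreAt (interaction G) β x v * scoreAt (interaction G) β x w)
      ≤ (2 + p * β) * (2 * p / N) := by
  set J := interaction G with hJ
  have horth := sum_weight_mul_eq_zero hp G β v
    (g := fun x => localField J x v * ((scoreAt J β x w + scoreAt J β (flipAt v x) w) / 2))
    (fun x => by
      simp only [hJ, localField_flipAt_same hp, flipAt_flipAt]
      ring)
  have hsplit : ∀ x, weight J β x * (scoreAt J β x v * scoreAt J β x w)
      ≤ weight J β x * ((spin (x v) - Real.tanh (p * β * localField J x v)) *
          (localField J x v * ((scoreAt J β x w + scoreAt J β (flipAt v x) w) / 2)))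
        + weight J β x * ((2 + p * β) * (2 * p / N)) := by
    intro x
    rw [← mul_add]
    refine mul_le_mul_of_nonneg_left ?_ (weight_nonneg J β x)
    have e : scoreAt J β x v * scoreAt J β x w
        = (spin (x v) - Real.tanh (p * β * localField J x v)) *
          (localField J x v * ((scoreAt J β x w + scoreAt J β (flipAt v x) w) / 2))
          + scoreAt J β x v * ((scoreAt J β x w - scoreAt J β (flipAt v x) w) / 2) := by
      rw [scoreAt]; ring
    rw [e]
    refine add_le_add_right ((le_abs_self _).trans ?_) _
    have h1 := abs_scoreAt_le hp hN G β x v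
    have h2 := abs_scoreAt_sub_le hp hN G hβ x hvw
    rw [abs_mul, abs_div, abs_two]
    rw [← hJ] at h1 h2
    have := mul_le_mul h1 h2 (abs_nonneg _) zero_le_two
    linarith
  refine (Finset.sum_le_sum fun x _ => hsplit x).trans ?_
  rw [Finset.sum_add_distrib, horth, ← Finset.sum_mul, sum_weight]
  linarith

/-- The constant in `sum_weight_score_sq_le`. -/
noncomputable def scoreConst (p : ℕ) (β : ℝ) : ℝ := 4 + (2 + p * β) * (2 * p)

theorem sum_weight_score_sq_le (hp : 2 ≤ p) (hN : 0 < N) (G : Hypergraph p N) {β : ℝ}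
    (hβ : 0 ≤ β) :
    ∑ x, weight (interaction G) β x * score (interaction G) β x ^ 2 ≤ scoreConst p β * N := by
  have hN' : (0 : ℝ) < N := by exact_mod_cast hN
  set J := interaction G with hJ
  have hexp : ∀ x, weight J β x * score J β x ^ 2
      = ∑ v, ∑ w, weight J β x * (scoreAt J β x v * scoreAt J β x w) := by
    intro x
    rw [score_eq_sum hp, sq, Finset.sum_mul_sum, Finset.mul_sum]
    simp_rw [Finset.mul_sum]
  simp_rw [hexp]
  rw [Finset.sum_comm]
  have hv : ∀ v, ∑ x, ∑ w, weight J β x * (scoreAt J β x v * scoreAt J β x w)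
      ≤ scoreConst p β := by
    intro v
    rw [Finset.sum_comm, ← Finset.add_sum_erase _ _ (Finset.mem_univ v)]
    have h1 : ∑ x, weight J β x * (scoreAt J β x v * scoreAt J β x v) ≤ 4 := by
      calc _ ≤ ∑ x, weight J β x * 4 := by
            refine Finset.sum_le_sum fun x _ => mul_le_mul_of_nonneg_left ?_ (weight_nonneg J β x)
            have := abs_scoreAt_le hp hN G β x v
            rw [← hJ] at this
            rw [← abs_mul_abs_self]
            nlinarith [abs_nonneg (scoreAt J β x v)]
        _ = 4 := by rw [← Finset.sum_mul, sum_weight, one_mul]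
    have h2 : ∑ w ∈ Finset.univ.erase v, ∑ x, weight J β x * (scoreAt J β x v * scoreAt J β x w)
        ≤ (2 + p * β) * (2 * p) := by
      refine (Finset.sum_le_sum fun w hw =>
        sum_weight_scoreAt_mul_le hp hN G hβ (Finset.mem_erase.1 hw).1).trans ?_
      rw [Finset.sum_const, nsmul_eq_mul]
      have hc : ((Finset.univ.erase v).card : ℝ) ≤ N := by
        exact_mod_cast (Finset.card_le_univ _).trans (by simp)
      have h3 : 0 ≤ (2 + p * β) * (2 * p / N) := by positivity
      refine (mul_le_mul_of_nonneg_right hc h3).trans (le_of_eq ?_)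
      field_simp
    unfold scoreConst
    linarith
  refine (Finset.sum_le_sum fun v _ => hv v).trans ?_
  simp [mul_comm]

end Score

/-! ### Consistency of the pseudo-likelihood estimate -/

section Mple

variable {p N : ℕ}

theorem sq_hamiltonian_le (hp : 2 ≤ p) (J : Tensor p N) (x : Config N) :
    hamiltonian J x ^ 2 ≤ N * ∑ v, localField J x v ^ 2 := by
  rw [hamiltonian_eq_sum_localField hp]
  refine (Finset.sum_mul_sq_le_sq_mul_sq _ _ _).trans (le_of_eq ?_)
  congr 1
  simp [sq, spin_mul_self]

/-- Cauchy–Schwarz turns a Hamiltonian of order `N` into local fields whose squares sum to order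
`N`. Each square contributes to the decrease of the score, and the `cosh` factor bounds the slope of
`tanh` from below on the range of the arguments. -/
theorem le_score_sub (hp : 2 ≤ p) (hN : 0 < N) (G : Hypergraph p N) (x : Config N) {ε R a b : ℝ}
    (hε : 0 ≤ ε) (hH : ε * N ≤ hamiltonian (interaction G) x) (ha : 0 ≤ a) (hab : a ≤ b)
    (hb : b ≤ R) :
    p * ε ^ 2 / Real.cosh (p * R) ^ 2 * N * (b - a)
      ≤ score (interaction G) a x - score (interaction G) b x := by
  have hN' : (0 : ℝ) < N := by exact_mod_cast hN
  have hp' : (0 : ℝ) ≤ p := Nat.cast_nonneg p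
  set J := interaction G with hJ
  have hm : ε ^ 2 * N ≤ ∑ v, localField J x v ^ 2 := by
    have h1 := sq_hamiltonian_le hp J x
    have h2 : (ε * N) ^ 2 ≤ hamiltonian J x ^ 2 := pow_le_pow_left₀ (by positivity) hH 2
    refine le_of_mul_le_mul_left ?_ hN'
    linarith
  have hterm : ∀ v, (p * b - p * a) * localField J x v ^ 2 / Real.cosh (p * R) ^ 2
      ≤ localField J x v * Real.tanh (p * b * localField J x v)
        - localField J x v * Real.tanh (p * a * localField J x v) := fun v =>
    le_mul_tanh_sub (abs_localField_le hp hN G x v) (by positivity)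
      (mul_le_mul_of_nonneg_left hab hp') (mul_le_mul_of_nonneg_left hb hp')
  have hsum := Finset.sum_le_sum fun v (_ : v ∈ Finset.univ) => hterm v
  rw [← Finset.sum_div, ← Finset.mul_sum, Finset.sum_sub_distrib] at hsum
  have e : score J a x - score J b x = ∑ v, localField J x v * Real.tanh (p * b * localField J x v)
      - ∑ v, localField J x v * Real.tanh (p * a * localField J x v) := by
    unfold score; ring
  rw [e]
  refine le_trans ?_ hsum
  have h3 : 0 ≤ (p * b - p * a) := by nlinarith
  have h4 := mul_le_mul_of_nonneg_left hm h3
  calc _ = (p * b - p * a) * (ε ^ 2 * N) / Real.cosh (p * R) ^ 2 := by ring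
    _ ≤ _ := div_le_div_of_nonneg_right h4 (by positivity)

theorem continuous_score (J : Tensor p N) (x : Config N) : Continuous fun b => score J b x := by
  unfold score
  refine continuous_const.sub (continuous_finsetSum _ fun v _ => continuous_const.mul ?_)
  exact continuous_tanh.comp (by fun_prop)

/-- If the score at `β` is of order at most `√N` and the Hamiltonian is of order `N`, then the
pseudo-likelihood estimate is at distance of order at most `1 / √N` from `β`. -/
theorem exists_mple_eq (hp : 2 ≤ p) (hN : 0 < N) (G : Hypergraph p N) (x : Config N)
    {β ε M : ℝ} (hβ : 0 ≤ β) (hε : 0 < ε) (hM : 0 ≤ M)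
    (hH : ε * N ≤ hamiltonian (interaction G) x)
    (hS : |score (interaction G) β x| ≤ M * √(N : ℝ))
    (hNM : M / (p * ε ^ 2 / Real.cosh (p * (β + 1)) ^ 2) ≤ √(N : ℝ)) :
    ∃ b : ℝ, mple (interaction G) x = (b : EReal) ∧
      √(N : ℝ) * |b - β| ≤ M / (p * ε ^ 2 / Real.cosh (p * (β + 1)) ^ 2) := by
  have hN' : (0 : ℝ) < N := by exact_mod_cast hN
  have hp' : (0 : ℝ) < p := by exact_mod_cast (by omega : 0 < p)
  have hsq : √(N : ℝ) * √(N : ℝ) = N := Real.mul_self_sqrt hN'.le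
  have hsqpos : 0 < √(N : ℝ) := Real.sqrt_pos.2 hN'
  set κ := p * ε ^ 2 / Real.cosh (p * (β + 1)) ^ 2 with hκ
  have hκpos : 0 < κ := by
    have := Real.cosh_pos (p * (β + 1))
    positivity
  set J := interaction G with hJ
  -- Chosen so that moving the parameter by `r` lowers the score by at least `M √N`, enough to
  -- cancel its value at `β`; `r ≤ 1` keeps the move in the range where `κ` is valid.
  set r := M / κ / √(N : ℝ) with hr
  have hr0 : 0 ≤ r := by positivity
  have hr1 : r ≤ 1 := (div_le_one hsqpos).2 hNM
  have hκr : κ * N * r = M * √(N : ℝ) := by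
    have h : κ * (√(N : ℝ) * √(N : ℝ)) * (M / κ / √(N : ℝ)) = M * √(N : ℝ) := by field_simp
    rwa [hsq] at h
  have hanti : ∀ a b, 0 ≤ a → a < b → score J b x < score J a x := by
    intro a b ha hab
    have h := le_score_sub hp hN G x hε.le hH ha hab.le le_rfl
    have h2 : 0 < p * ε ^ 2 / Real.cosh (p * b) ^ 2 * N * (b - a) := by
      have := Real.cosh_pos (p * b)
      have := sub_pos.2 hab
      positivity
    linarith
  have h0 : 0 ≤ score J 0 x := by
    have : 0 ≤ hamiltonian J x := le_trans (by positivity) hH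
    simpa [score] using this
  have h1 : score J (β + r) x ≤ 0 := by
    have h := le_score_sub hp hN G x hε.le hH hβ (by linarith : β ≤ β + r)
      (by linarith : β + r ≤ β + 1)
    rw [add_sub_cancel_left, ← hκ, hκr] at h
    linarith [(abs_le.1 hS).2]
  obtain ⟨b, ⟨hb0, hb1⟩, hb⟩ := intermediate_value_Icc' (by positivity : 0 ≤ β + r)
    (continuous_score J x).continuousOn ⟨h1, h0⟩
  simp only at hb
  have huniq : ∀ c, 0 ≤ c → score J c x = 0 → c = b := by
    intro c hc0 hc
    rcases lt_trichotomy c b with h | h | h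
    · have := hanti c b hc0 h; linarith
    · exact h
    · have := hanti b c hb0 h; linarith
  refine ⟨b, ?_, ?_⟩
  -- The score is strictly decreasing, so the solution set in the definition of `mple` is a
  -- singleton and its infimum is that zero.
  · have hset : {c : EReal | ∃ b : ℝ, 0 ≤ b ∧ c = (b : EReal) ∧
        hamiltonian J x = ∑ v : Fin N, localField J x v * Real.tanh (p * b * localField J x v)}
        = {(b : EReal)} := by
      ext c
      rw [Set.mem_singleton_iff]
      constructor
      · rintro ⟨c, hc0, rfl, hc⟩
        rw [huniq c hc0 (sub_eq_zero.2 hc)]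
      · rintro rfl
        exact ⟨b, hb0, rfl, sub_eq_zero.1 hb⟩
    rw [mple, hset, sInf_singleton]
  · have hdist : κ * N * |b - β| ≤ M * √(N : ℝ) := by
      refine le_trans ?_ hS
      rcases le_total b β with h | h
      · have h2 := le_score_sub hp hN G x hε.le hH hb0 h (by linarith : β ≤ β + 1)
        rw [← hJ, hb] at h2
        rw [abs_sub_comm, abs_of_nonneg (sub_nonneg.2 h)]
        exact h2.trans ((le_abs_self _).trans (by simp))
      · have h2 := le_score_sub hp hN G x hε.le hH hβ h (by linarith : b ≤ β + 1)
        rw [← hJ, hb] at h2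
        rw [abs_of_nonneg (sub_nonneg.2 h)]
        exact h2.trans ((le_abs_self _).trans (by simp))
    rw [le_div_iff₀ hκpos]
    refine le_of_mul_le_mul_right ?_ hsqpos
    calc √(N : ℝ) * |b - β| * κ * √(N : ℝ) = κ * (√(N : ℝ) * √(N : ℝ)) * |b - β| := by ring
      _ ≤ _ := by rw [hsq]; exact hdist

/-- Each such configuration has weight at most `exp (β u) / (2^N Z)`, and there are at most `2^N` of
them; an extensive free energy thus rules out a small Hamiltonian. -/
theorem ising_real_hamiltonian_le (J : Tensor p N) {β : ℝ} (hβ : 0 ≤ β) (u : ℝ) :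
    (ising J β).real {x | hamiltonian J x ≤ u} ≤ Real.exp (β * u - logPartition J β) := by
  classical
  have hZ := partition_pos J β
  rw [ising_real]
  have h : ∀ x ∈ Finset.univ.filter (fun x => x ∈ {x | hamiltonian J x ≤ u}),
      weight J β x ≤ Real.exp (β * u - logPartition J β) / 2 ^ N := by
    intro x hx
    have hx' : hamiltonian J x ≤ u := (Finset.mem_filter.1 hx).2
    rw [Real.exp_sub, logPartition, Real.exp_log hZ, div_div, mul_comm (partition J β), weight]
    gcongr
  refine (Finset.sum_le_sum h).trans ?_
  rw [Finset.sum_const, nsmul_eq_mul]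
  have hc : ((Finset.univ.filter (fun x => x ∈ {x | hamiltonian J x ≤ u})).card : ℝ) ≤ 2 ^ N := by
    exact_mod_cast (Finset.card_le_univ _).trans (by simp)
  refine (mul_le_mul_of_nonneg_right hc (by positivity)).trans (le_of_eq ?_)
  field_simp

theorem ising_real_score_le (hp : 2 ≤ p) (hN : 0 < N) (G : Hypergraph p N) {β M : ℝ}
    (hβ : 0 ≤ β) (hM : 0 < M) :
    (ising (interaction G) β).real {x | M * √(N : ℝ) < |score (interaction G) β x|}
      ≤ scoreConst p β / M ^ 2 := by
  have hN' : (0 : ℝ) < N := by exact_mod_cast hN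
  have hsub : {x | M * √(N : ℝ) < |score (interaction G) β x|}
      ⊆ {x | M ^ 2 * N ≤ score (interaction G) β x ^ 2} := by
    intro x hx
    simp only [Set.mem_ofPred_eq] at hx ⊢
    rw [← sq_abs (score _ _ _), ← Real.sq_sqrt hN'.le, ← mul_pow]
    exact pow_le_pow_left₀ (by positivity) hx.le 2
  refine (measureReal_mono hsub).trans ?_
  have h := mul_meas_ge_le_integral_of_nonneg (μ := ising (interaction G) β)
    (f := fun x => score (interaction G) β x ^ 2)
    (Eventually.of_forall fun x => sq_nonneg _) Integrable.of_finite (M ^ 2 * N)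
  rw [integral_ising] at h
  have h2 := h.trans (sum_weight_score_sq_le hp hN G hβ)
  rw [le_div_iff₀ (by positivity)]
  refine le_of_mul_le_mul_right ?_ hN'
  linarith

theorem one_sub_lt_ising_real_mple (hp : 2 ≤ p) (hN : 0 < N) (G : Hypergraph p N)
    {β ε M δ : ℝ} (hβ : 0 ≤ β) (hε : 0 < ε) (hM : 0 < M)
    (hNM : M / (p * ε ^ 2 / Real.cosh (p * (β + 1)) ^ 2) ≤ √(N : ℝ))
    (hδ : scoreConst p β / M ^ 2
      + Real.exp (β * (ε * N) - logPartition (interaction G) β) < δ) :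
    1 - δ < (ising (interaction G) β).real {x | ∃ b : ℝ, mple (interaction G) x = (b : EReal) ∧
      √(N : ℝ) * |b - β| ≤ M / (p * ε ^ 2 / Real.cosh (p * (β + 1)) ^ 2)} := by
  set S := {x | ∃ b : ℝ, mple (interaction G) x = (b : EReal) ∧
      √(N : ℝ) * |b - β| ≤ M / (p * ε ^ 2 / Real.cosh (p * (β + 1)) ^ 2)} with hS
  have hsub : Sᶜ ⊆ {x | M * √(N : ℝ) < |score (interaction G) β x|}
      ∪ {x | hamiltonian (interaction G) x ≤ ε * N} := by
    intro x hx
    by_contra hcon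
    simp only [Set.mem_union, Set.mem_ofPred_eq, not_or, not_lt, not_le] at hcon
    exact hx (exists_mple_eq hp hN G x hβ hε hM.le hcon.2.le hcon.1 hNM)
  have h1 := (measureReal_mono (μ := ising (interaction G) β) hsub).trans
    (measureReal_union_le _ _)
  rw [probReal_compl_eq_one_sub (Set.toFinite S).measurableSet] at h1
  have h2 := ising_real_score_le hp hN G hβ hM
  have h3 := ising_real_hamiltonian_le (interaction G) hβ (ε * N)
  linarith

end Mple

theorem exists_ae_eventually_mple {p K : ℕ} (hp : 2 ≤ p) {lam : Fin K → ℝ}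
    (h0 : ∀ j, 0 ≤ lam j) (h1 : ∑ j, lam j = 1) {θ : (Fin p → Fin K) → ℝ}
    (hθ : ∀ j, θ j ∈ Set.Icc (0 : ℝ) 1)
    (hs : ∀ (σ : Equiv.Perm (Fin p)) (j : Fin p → Fin K), θ (j ∘ σ) = θ j)
    {Ω : Type*} [MeasurableSpace Ω] (P : Measure Ω) (H : ∀ N : ℕ, Ω → Hypergraph p N)
    (hH : ∀ N, HasLaw (H N) (law lam θ N) P)
    {β : ℝ} (hlt : betaStar lam θ < (β : EReal)) {δ : ℝ} (hδ : 0 < δ) :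
    ∃ M : ℝ, 0 < M ∧ ∀ᵐ ω ∂P, ∀ᶠ N : ℕ in atTop,
      1 - δ < (ising (interaction (H N ω)) β).real
        {x | ∃ b : ℝ, mple (interaction (H N ω)) x = (b : EReal) ∧ √(N : ℝ) * |b - β| ≤ M} := by
  have hβ := pos_of_betaStar_lt hp h0 hlt
  have hp' : (0 : ℝ) < p := by exact_mod_cast (by omega : 0 < p)
  obtain ⟨η, hη, hF⟩ := exists_ae_eventually_le_logPartition hp h0 h1 hθ hs P H hH hlt
  -- With this `ε` the exponent `β ε N` uses half of the free energy `η N`, leaving an exponentially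
  -- small probability; `M` below makes the Chebyshev bound on the score exactly `δ / 2`.
  set ε := η / (2 * β) with hε
  have hεpos : 0 < ε := by positivity
  have hCpos : 0 < scoreConst p β := by unfold scoreConst; positivity
  set M := √(2 * scoreConst p β / δ) with hM
  have hMpos : 0 < M := Real.sqrt_pos.2 (by positivity)
  have hMsq : scoreConst p β / M ^ 2 = δ / 2 := by
    rw [hM, Real.sq_sqrt (by positivity)]; field_simp
  have hcosh := Real.cosh_pos (p * (β + 1))
  refine ⟨M / (p * ε ^ 2 / Real.cosh (p * (β + 1)) ^ 2), by positivity, ?_⟩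
  have hsqrt : Tendsto (fun N : ℕ => √(N : ℝ)) atTop atTop :=
    Real.tendsto_sqrt_atTop.comp tendsto_natCast_atTop_atTop
  have hexp : Tendsto (fun N : ℕ => Real.exp (-(η / 2 * N))) atTop (𝓝 0) :=
    Real.tendsto_exp_neg_atTop_nhds_zero.comp
      (tendsto_natCast_atTop_atTop.const_mul_atTop (by positivity))
  filter_upwards [hF] with ω hω
  filter_upwards [hω, eventually_gt_atTop 0, hsqrt.eventually_ge_atTop
    (M / (p * ε ^ 2 / Real.cosh (p * (β + 1)) ^ 2)),
    hexp.eventually (gt_mem_nhds (by positivity : 0 < δ / 2))] with N hN1 hN2 hN3 hN4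
  refine one_sub_lt_ising_real_mple hp hN2 (H N ω) hβ.le hεpos hMpos hN3 ?_
  have h2 : Real.exp (β * (ε * N) - logPartition (interaction (H N ω)) β)
      ≤ Real.exp (-(η / 2 * N)) := by
    rw [Real.exp_le_exp, hε]
    have : β * (η / (2 * β) * N) = η / 2 * N := by field_simp
    rw [this]
    linarith
  rw [hMsq]
  linarith

end HSBM

theorem mainTheorem4 {p K : ℕ} (hp : 2 ≤ p)
    (lam : Fin K → ℝ) (hlam : ∀ j, 0 ≤ lam j) (hlam_sum : ∑ j, lam j = 1)
    (θ : (Fin p → Fin K) → ℝ) (hθ : ∀ j, θ j ∈ Set.Icc (0 : ℝ) 1)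
    (hθ_symm : ∀ (σ : Equiv.Perm (Fin p)) (j : Fin p → Fin K), θ (j ∘ σ) = θ j)
    {Ω : Type*} [MeasurableSpace Ω] (P : Measure Ω) [IsProbabilityMeasure P]
    (H : ∀ N : ℕ, Ω → HSBM.Hypergraph p N)
    (hH : ∀ N, HasLaw (H N) (HSBM.law lam θ N) P) :
    -- above the threshold, the MPL estimate is `√N`-consistent for almost every realization
    (∀ β : ℝ, HSBM.betaStar lam θ < (β : EReal) →
      ∀ δ : ℝ, 0 < δ → ∃ M : ℝ, 0 < M ∧ ∀ᵐ ω ∂P, ∀ᶠ N : ℕ in atTop,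
        1 - δ < (HSBM.ising (HSBM.interaction (H N ω)) β).real
          {x | ∃ b : ℝ, HSBM.mple (HSBM.interaction (H N ω)) x = (b : EReal) ∧
            √(N : ℝ) * |b - β| ≤ M}) ∧
    -- below the threshold, for almost every realization no sequence of estimators (which may
    -- depend on the realization) is consistent at two distinct parameter values
    (∀ᵐ ω ∂P, ∀ β₁ β₂ : ℝ, 0 ≤ β₁ → β₁ < β₂ → (β₂ : EReal) < HSBM.betaStar lam θ →
      ¬ ∃ est : ∀ N : ℕ, HSBM.Config N → EReal,
        HSBM.ConsistentAt (fun N => HSBM.interaction (H N ω)) est β₁ ∧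
        HSBM.ConsistentAt (fun N => HSBM.interaction (H N ω)) est β₂) ∧
    -- below the threshold, `𝔼 F_N(β) = O(1)`
    (∀ β : ℝ, 0 ≤ β → (β : EReal) < HSBM.betaStar lam θ →
      ∃ C : ℝ, ∀ N : ℕ,
        |∫ G, HSBM.logPartition (HSBM.interaction G) β ∂(HSBM.law lam θ N)| ≤ C) ∧
    -- below the threshold, the Kullback-Leibler divergence of the joint laws stays bounded
    (∀ β₁ β₂ : ℝ, 0 ≤ β₁ → β₁ < β₂ → (β₂ : EReal) < HSBM.betaStar lam θ →
      ∃ C : ℝ, ∀ N : ℕ,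
        InformationTheory.klDiv (HSBM.jointLaw lam θ N β₁) (HSBM.jointLaw lam θ N β₂)
          ≤ ENNReal.ofReal C) := by
  refine ⟨fun β hlt δ hδ =>
      HSBM.exists_ae_eventually_mple hp hlam hlam_sum hθ hθ_symm P H hH hlt hδ,
    HSBM.ae_not_consistentAt hp hlam hlam_sum hθ hθ_symm P H hH,
    fun β hβ hlt =>
      HSBM.exists_abs_integral_logPartition_le hp hlam hlam_sum hθ hθ_symm hβ hlt, ?_⟩
  intro β₁ β₂ hβ₁ h12 hlt
  obtain ⟨C, hC⟩ := HSBM.exists_abs_integral_logPartition_le hp hlam hlam_sum hθ hθ_symm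
    (hβ₁.trans h12.le) hlt
  refine ⟨C, fun N => ?_⟩
  obtain ⟨b, hb⟩ := HSBM.exists_blockIndex lam hlam hlam_sum N
  have := HSBM.isProbabilityMeasure_law hb hθ
  exact (HSBM.klDiv_jointLaw_le hp hβ₁ h12.le).trans
    (ENNReal.ofReal_le_ofReal ((le_abs_self _).trans (hC N)))
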